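/- Let $n\in\mathbb N$ and $\mathbf s=(s_1,\dots,s_n)\in\mathbb N^n$ (zero entries allowed). **$\mathbf s$-bushes.** An $\mathbf s$-bush is a rooted plane graph with internal nodes labeled by $[n]$ obtained as follows: start with a root carrying a single leaf; at step $j=1,\dots,n$, attach a new node $j$ either to one leaf or to two consecutive leaves, and give it $s_j+1$ leaves (two leaves if $s_j=0$ and $j$ is attached to two leaves). Edges are oriented from the root to the leaves, node $j$ is drawn at level $j$, and $i$ is an ancestor of $j$ if there is an increasing path from $i$ to $j$ (each node is an ancestor of itself). Multiple edges are allowed. The rank of a bush is its number of nodes of indegree $1$. **Insertion and fibers.** For $\mathbf x\in\mathbb R^n$, the $\mathbf s$-bush $\mathrm{ins}(\mathbf s,\mathbf x)$ is built step by step, with a label $(u,\rho)\in[n]\times\mathbb N$ in each gap between consecutive leaves, and with outer labels $(0,0)$ on the far left and $(n+1,0)$ on the far right, where $x_0=-\infty$ and $x_{n+1}=+\infty$. At step $j$: attach $j$ to the leaf between two labels $(u,\rho),(v,\sigma)$ with $x_u-\rho<x_j<x_v-\sigma$, or to the two leaves around a label $(w,\tau)$ with $x_j=x_w-\tau$ (in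 which case this label disappears); label the gaps between the new leaves $(j,s_j-1),\dots,(j,0)$ from left to right (a single label $(j,0)$ if $s_j=0$ and $j$ has indegree $2$); add $\max(0,s_j-1)$ to the second entry of all labels to the left of $j$. The fiber of an $\mathbf s$-bush $B$ is $\{\mathbf x\in\mathbb R^n:\mathrm{ins}(\mathbf s,\mathbf x)=B\}$, and its closed fiber is the closure of the fiber. **Holes, ascents, descents.** A hole of $B$ is a pair $(i,j)$ such that $j$ has two incoming edges and $i$ is the greatest common ancestor of their sources. The left (resp. right) zigzag of $j$ starts at $j$ and follows leftmost (resp. rightmost) outgoing edges until it reaches a leaf, or arrives at a node $k$ of indegree $2$ through the right (resp. left) incoming edge of $k$, in which case it continues with the right (resp. left) zigzag of $k$. An ascent (resp. descent) of $B$ is a pair $(i,j)$ such that $j$ has indegree $1$; $i$ is the greatest ancestor of $j$ such that the leftmost (resp. rightmost) increasing path from $i$ to $j$ takes the leftmost (resp. rightmost) outgoing edge at each node except at $i$ (where it takes another edge); and either $s_j=0$ or all nodes other than $j$ on the left (resp. right) zigzag of $j$ have indegree $2$. **Right-hand sides.** Let $i<j$ with $i$ an ancestor of $j$, and let $\pi$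 be the leftmost (resp. rightmost) increasing path from $i$ to $j$, among those arriving through the right (resp. left) incoming edge of $j$ if $(i,j)$ is a hole. Define $\mu(B,i,j)$ (resp. $\nu(B,i,j)$) as $r-1+\sum_{k\in K}\max(0,s_k-1)$, where $r$ is the number of outgoing edges of $i$ weakly (resp. strictly) to the right of $\pi$, and $K$ is the set of nodes $k$ with $i<k<j$ that are weakly (resp. strictly) to the right of $\pi$. **Statement.** For every $\mathbf s$-bush $B$, the closed fiber of $B$ is the set of $\mathbf x\in\mathbb R^n$ that satisfy - the equality $x_i-x_j=\mu(B,i,j)$ for each hole $(i,j)$ of $B$, - the inequality $x_i-x_j\le\mu(B,i,j)$ for each ascent $(i,j)$ of $B$, - the inequality $x_i-x_j\ge\nu(B,i,j)$ for each descent $(i,j)$ of $B$. This description is irredundant: for each of these equalities and inequalities, there is a point of $\mathbb R^n$ that violates it and satisfies all the others. Moreover, the closed fiber is non-empty and its dimension (that of its affine span) is the rank of $B$. -/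

import Mathlib

namespace SBush

/-- A half-edge leaving a vertex: its source (`none` is the root, `some j` the internal node `j`) and
its position `0, 1, 2, …` among the outgoing edges of its source, counted from left to right. -/
abbrev Edge (n : ℕ) := Option (Fin n) × ℕ

/-- The combinatorial data of a rooted plane graph drawn upwards, with internal nodes labelled by
`Fin n`: the number of outgoing edges of each node and the list, from left to right, of its incoming
edges. The root has a single outgoing edge `(none, 0)`. An edge that is incoming at no node ends
at a leaf. -/
@[ext]
structure Bush (n : ℕ) where
  out : Fin n → ℕ
  inc : Fin n → List (Edge n)

/-- Left and right. -/
inductive Side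
  | left
  | right

/-- The opposite side. -/
def Side.opp : Side → Side
  | .left => .right
  | .right => .left

/-- The number of outgoing edges of a new node with parameter `a` that is attached to `m` leaves:
`a + 1`, except that it is `2` if `a = 0` and `m = 2`. -/
def numOut (a m : ℕ) : ℕ := if a = 0 ∧ m = 2 then 2 else a + 1

/-- The `d` edges leaving the node `j`, from left to right. -/
def edgesFrom {n : ℕ} (j : Fin n) (d : ℕ) : List (Edge n) :=
  (List.range d).map fun t => (some j, t)

namespace Bush

variable {n : ℕ}

/-- The leaves, from left to right, of the graph obtained by deleting all nodes except the first `k`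
ones (a leaf is given by the edge that carries it). In other words, the edges that reach the
level of the node of index `k`, from left to right. When a node is attached, the
leaves to which it is attached are replaced by its own leaves. -/
def front (B : Bush n) : ℕ → List (Edge n)
  | 0 => [(none, 0)]
  | k + 1 =>
    if h : k < n then
      (B.front k).flatMap fun e =>
        if (B.inc ⟨k, h⟩).head? = some e then edgesFrom ⟨k, h⟩ (B.out ⟨k, h⟩)
        else if e ∈ B.inc ⟨k, h⟩ then [] else [e]
    else B.front k

/-- `B` is an `s`-bush: each node `j`, in increasing order, is attached to one leaf or to two
consecutive leaves of the graph formed by the smaller nodes, and carries `s j + 1` outgoing edges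
(two outgoing edges if `s j = 0` and `j` is attached to two leaves). -/
def IsSBush (s : Fin n → ℕ) (B : Bush n) : Prop :=
  ∀ j : Fin n,
    B.inc j <:+: B.front j ∧
    ((B.inc j).length = 1 ∨ (B.inc j).length = 2) ∧
    B.out j = numOut (s j) (B.inc j).length

/-- The rank: the number of nodes of indegree one. -/
def rank (B : Bush n) : ℕ := (Finset.univ.filter fun j => (B.inc j).length = 1).card

/-- `p` is (the list of edges of) an increasing path from the node `i` to the node `j`. -/
inductive IsPath (B : Bush n) : Fin n → Fin n → List (Edge n) → Prop
  | nil (i : Fin n) : IsPath B i i []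
  | cons {i k j : Fin n} {t : ℕ} {p : List (Edge n)} :
      (some i, t) ∈ B.inc k → IsPath B k j p → IsPath B i j ((some i, t) :: p)

/-- `i` is an ancestor of `j` (each node is an ancestor of itself). -/
def IsAncestor (B : Bush n) (i j : Fin n) : Prop := ∃ p, B.IsPath i j p

/-- `p` is the leftmost, or rightmost, path among the paths with the property `P`, that share their
starting point. Paths are compared at the node where they separate,
that is, lexicographically through the positions of their edges. -/
def IsExtreme (P : List (Edge n) → Prop) : Side → List (Edge n) → Prop
  | .left, p => P p ∧ ∀ q, P q → p.map Prod.snd ≤ q.map Prod.snd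
  | .right, p => P p ∧ ∀ q, P q → q.map Prod.snd ≤ p.map Prod.snd

/-- The leftmost, or rightmost, outgoing edge of `k`. -/
def exit (B : Bush n) : Side → Fin n → Edge n
  | .left, k => (some k, 0)
  | .right, k => (some k, B.out k - 1)

/-- `e` is the leftmost, or rightmost, outgoing edge of its source. -/
def IsExit (B : Bush n) (d : Side) (e : Edge n) : Prop := ∃ k, e = B.exit d k

/-- A hole `(i, j)`: the node `j` has two incoming edges, and `i` is their greatest common ancestor. -/
def IsHole (B : Bush n) (i j : Fin n) : Prop :=
  ∃ a b t u, B.inc j = [(some a, t), (some b, u)] ∧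
    IsGreatest {k | B.IsAncestor k a ∧ B.IsAncestor k b} i

/-- The edge `e` is the incoming edge of `k` on the side opposite to `d`, and `k` has another incoming
edge. -/
def Crosses (B : Bush n) : Side → Edge n → Fin n → Prop
  | .left, e, k => ∃ f, B.inc k = [f, e]
  | .right, e, k => ∃ f, B.inc k = [e, f]

/-- `B.Zigzag d j d' k`: the left (`d = left`) or right (`d = right`) zigzag of `j` visits `k` and
leaves it, if at all, through its extreme edge on the side `d'`. The left zigzag follows
leftmost edges until it arrives at a node of indegree two through its right incoming edge,
where it becomes the right zigzag of this node; symmetrically for the right zigzag. -/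
inductive Zigzag (B : Bush n) (d : Side) (j : Fin n) : Side → Fin n → Prop
  | start : Zigzag B d j d j
  | keep {d' : Side} {k m : Fin n} : Zigzag B d j d' k → B.exit d' k ∈ B.inc m →
      ¬ B.Crosses d' (B.exit d' k) m → Zigzag B d j d' m
  | turn {d' : Side} {k m : Fin n} : Zigzag B d j d' k → B.exit d' k ∈ B.inc m →
      B.Crosses d' (B.exit d' k) m → Zigzag B d j d'.opp m

/-- The leftmost, or rightmost, increasing path from `i` to `j` takes the leftmost, or rightmost,
outgoing edge at each node except at `i`. -/
def TurnsOnlyAt (B : Bush n) (d : Side) (i j : Fin n) : Prop :=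
  ∃ e p, IsExtreme (B.IsPath i j) d (e :: p) ∧ ¬ B.IsExit d e ∧ ∀ f ∈ p, B.IsExit d f

/-- The common definition of ascents (`d = left`) and descents (`d = right`). -/
def IsSlope (s : Fin n → ℕ) (B : Bush n) (d : Side) (i j : Fin n) : Prop :=
  (B.inc j).length = 1 ∧
  IsGreatest {k | B.TurnsOnlyAt d k j} i ∧
  (s j = 0 ∨ ∀ d' k, B.Zigzag d j d' k → k ≠ j → (B.inc k).length = 2)

/-- Ascents of an `s`-bush. -/
def IsAscent (s : Fin n → ℕ) (B : Bush n) (i j : Fin n) : Prop := IsSlope s B .left i j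

/-- Descents of an `s`-bush. -/
def IsDescent (s : Fin n → ℕ) (B : Bush n) (i j : Fin n) : Prop := IsSlope s B .right i j

/-- The node `k` is the end of an edge of the path `p`. -/
def OnPath (B : Bush n) (p : List (Edge n)) (k : Fin n) : Prop := ∃ e ∈ p, e ∈ B.inc k

/-- The node `k` is strictly to the right of the path `p`: it is not on `p`, and at the level of `k`
the path `p` uses an edge to the left of the incoming edges of `k`. -/
def RightOf (B : Bush n) (p : List (Edge n)) (k : Fin n) : Prop :=
  ¬ B.OnPath p k ∧ ∃ e ∈ p, ∃ f ∈ B.inc k, [e, f].Sublist (B.front k)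

open Classical in
/-- The sum of `max (0, s k - 1)` over the nodes `i < k < j` that satisfy `R`. -/
noncomputable def weight (s : Fin n → ℕ) (i j : Fin n) (R : Fin n → Prop) : ℤ :=
  ∑ k ∈ Finset.univ.filter (fun k => i < k ∧ k < j ∧ R k), max 0 ((s k : ℤ) - 1)

/-- An increasing path from `i` to `j` that, if `(i, j)` is a hole, arrives through the right
(`d = left`), or left (`d = right`), incoming edge of `j`. -/
def IsAdmissible (B : Bush n) (d : Side) (i j : Fin n) (p : List (Edge n)) : Prop :=
  B.IsPath i j p ∧ (B.IsHole i j → ∃ e ∈ p.getLast?, B.Crosses d e j)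

open Classical in
/-- `μ(B, i, j)`, for an ancestor `i < j` of `j` (and `0` otherwise): `r - 1` plus the total weight of
the nodes between `i` and `j` weakly to the right of `π`, where `π` is the leftmost admissible
path from `i` to `j` and `r` counts the outgoing edges of `i` weakly to the right of `π`. -/
noncomputable def mu (s : Fin n → ℕ) (B : Bush n) (i j : Fin n) : ℤ :=
  if h : ∃ π : Edge n × List (Edge n), IsExtreme (B.IsAdmissible .left i j) .left (π.1 :: π.2) then
    ((B.out i : ℤ) - h.choose.1.2) - 1 +
      weight s i j fun k => B.OnPath (h.choose.1 :: h.choose.2) k ∨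
        B.RightOf (h.choose.1 :: h.choose.2) k
  else 0

open Classical in
/-- `ν(B, i, j)`, for an ancestor `i < j` of `j` (and `0` otherwise): `r - 1` plus the total weight of
the nodes between `i` and `j` strictly to the right of `π`, where `π` is the rightmost admissible
path from `i` to `j` and `r` counts the outgoing edges of `i` strictly to the right of `π`. -/
noncomputable def nu (s : Fin n → ℕ) (B : Bush n) (i j : Fin n) : ℤ :=
  if h : ∃ π : Edge n × List (Edge n), IsExtreme (B.IsAdmissible .right i j) .right (π.1 :: π.2) then
    ((B.out i : ℤ) - h.choose.1.2 - 1) - 1 +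
      weight s i j fun k => B.RightOf (h.choose.1 :: h.choose.2) k
  else 0

end Bush

/-- A state of the insertion algorithm: the leaves from left to right, and the labels of the gaps
between consecutive leaves, from left to right. The two outer labels, whose values
are `-∞` and `+∞`, are left implicit. -/
structure State (n : ℕ) where
  leaves : List (Edge n)
  gaps : List (Fin n × ℕ)

namespace State

variable {n : ℕ}

/-- The number of gap labels `(u, ρ)`, from the left, before the first one with `v ≤ x u - ρ`. -/
noncomputable def pos (S : State n) (x : Fin n → ℝ) (v : ℝ) : ℕ :=
  (S.gaps.takeWhile fun g => decide (x g.1 - g.2 < v)).length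

open Classical in
/-- The number of leaves to which a node with value `v` is attached: two if the first gap label `(w, τ)`
with `v ≤ x w - τ` satisfies `v = x w - τ`, and one otherwise. -/
noncomputable def width (S : State n) (x : Fin n → ℝ) (v : ℝ) : ℕ :=
  if ∃ g ∈ S.gaps[S.pos x v]?, v = x g.1 - g.2 then 2 else 1

/-- The leaves to which a node with value `v` is attached: the leaf between the labels `(u, ρ)` and
`(v', σ)` with `x u - ρ < v < x v' - σ`, or the two leaves around the label `(w, τ)`
with `v = x w - τ`. -/
noncomputable def attached (S : State n) (x : Fin n → ℝ) (v : ℝ) : List (Edge n) :=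
  (S.leaves.drop (S.pos x v)).take (S.width x v)

/-- The insertion of the node `j`: its leaves replace those to which it is attached, its gap labels
are `(j, d - 2), …, (j, 1), (j, 0)` where `d` is its number of leaves, and
`max (0, s j - 1)` is added to the second entry of all gap labels on the left of `j`. -/
noncomputable def insert (s : Fin n → ℕ) (x : Fin n → ℝ) (S : State n) (j : Fin n) : State n where
  leaves := S.leaves.take (S.pos x (x j)) ++ edgesFrom j (numOut (s j) (S.width x (x j))) ++
    S.leaves.drop (S.pos x (x j) + S.width x (x j))
  gaps := (S.gaps.take (S.pos x (x j))).map (fun g => (g.1, g.2 + max 0 (s j - 1))) ++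
    (List.range (numOut (s j) (S.width x (x j)) - 1)).reverse.map (fun t => (j, t)) ++
    S.gaps.drop (S.pos x (x j) + S.width x (x j) - 1)

end State

variable {n : ℕ}

/-- The state of the insertion algorithm after the insertion of the first `k` nodes. -/
noncomputable def run (s : Fin n → ℕ) (x : Fin n → ℝ) : ℕ → State n
  | 0 => ⟨[(none, 0)], []⟩
  | k + 1 => if h : k < n then (run s x k).insert s x ⟨k, h⟩ else run s x k

/-- The bush built by the insertion algorithm from the point `x`. -/
noncomputable def ins (s : Fin n → ℕ) (x : Fin n → ℝ) : Bush n where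
  out j := numOut (s j) ((run s x j).width x (x j))
  inc j := (run s x j).attached x (x j)

/-- The fiber of a bush. -/
def fiber (s : Fin n → ℕ) (B : Bush n) : Set (Fin n → ℝ) := {x | ins s x = B}

/-- The closed fiber of a bush. -/
def closedFiber (s : Fin n → ℕ) (B : Bush n) : Set (Fin n → ℝ) := closure (fiber s B)

/-- Names of the equalities and inequalities, one for each hole, ascent and descent. -/
inductive Constraint (n : ℕ)
  | hole (i j : Fin n)
  | ascent (i j : Fin n)
  | descent (i j : Fin n)

/-- The system of equalities and inequalities attached to a bush. -/
def system (s : Fin n → ℕ) (B : Bush n) : Set (Constraint n) :=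
  {c | match c with
    | .hole i j => B.IsHole i j
    | .ascent i j => B.IsAscent s i j
    | .descent i j => B.IsDescent s i j}

/-- The point `x` satisfies the equality or inequality `c`. -/
def Constraint.Holds (s : Fin n → ℕ) (B : Bush n) (x : Fin n → ℝ) : Constraint n → Prop
  | .hole i j => x i - x j = B.mu s i j
  | .ascent i j => x i - x j ≤ B.mu s i j
  | .descent i j => x i - x j ≥ B.nu s i j

end SBush

/-! The proof follows the gap labels of the insertion algorithm symbolically. For a fixed bush,
`tag` records on each side of each leaf the node that created the label, its initial second entry
and what has been added since.

Fibers. As long as the coordinates fit, the labels held by the algorithm are these tags, and their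
values increase from left to right (`run_eq`). Hence the fiber is cut out by local conditions
(`mem_fiber_iff`): `x j` lies strictly between the two labels of the leaf to which `j` is attached,
or equals the label between the two leaves that `j` merges. The induction rests on a cancellation:
`s k - 1` is both what `k` adds to the labels on its left and the entry of its own leftmost gap. So
the order around the extreme leaves of `k` only says on which side of a label `x k` lies
(`leafOk_exit_left`, `leafOk_exit_right`). A point of the fiber is built one coordinate after the
other, and convexity turns strict inequalities into weak ones in the closure (`closedFiber_eq`).

Combinatorics. Tracing a label back to its creator produces an extreme path. Its creator is
therefore the `i` of the hole, ascent or descent (`isHole_iff`, `isSlope_iff`), and its second entry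
is the right-hand side (`SideTrail.tag_eq`, `mu_eq`, `nu_eq`).

Redundancy. If `s j ≠ 0`, an inequality at a node `j` of indegree one says that the labels around an
extreme leaf of `j` are in order. A node that merges this leaf with a neighbour passes the question
on to one of its own extreme leaves, and these leaves form the zigzag. If the zigzag meets another
node of indegree one, the value of that node is squeezed between the two labels and the inequality
follows (`Zigzag.implies`). Otherwise the disorder travels along the zigzag without obstructing any
later node, so the inequality can be violated alone. If `s j = 0`, the single leaf of `j` keeps its
labels and no disorder arises.

Dimension. The fiber is open within its equalities, and each equality expresses one coordinate by an
earlier one. The coordinates of the nodes of indegree one remain free (`direction_closedFiber`,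
`finrank_directions`). -/

namespace SBush

/-! ### Left-to-right order in a list without duplicates, encoded by two-element sublists -/

section Lists

variable {α : Type*}

theorem pair_sublist_append {a b : α} {X Y : List α} :
    [a, b].Sublist (X ++ Y) ↔ [a, b].Sublist X ∨ [a, b].Sublist Y ∨ (a ∈ X ∧ b ∈ Y) := by
  constructor
  · intro h
    obtain ⟨l₁, l₂, h, h₁, h₂⟩ := List.sublist_append_iff.1 h
    match l₁, h with
    | [], h => simp at h; subst h; exact .inr (.inl h₂)
    | [c], h =>
      simp at h
      obtain ⟨rfl, rfl⟩ := h
      exact .inr (.inr ⟨List.singleton_sublist.1 h₁, List.singleton_sublist.1 h₂⟩)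
    | [c, d], h =>
      simp at h
      obtain ⟨rfl, rfl, rfl⟩ := h
      exact .inl h₁
    | c :: d :: e :: l, h => simp at h
  · rintro (h | h | ⟨h₁, h₂⟩)
    · exact h.trans (List.sublist_append_left _ _)
    · exact h.trans (List.sublist_append_right _ _)
    · exact (List.singleton_sublist.2 h₁).append (List.singleton_sublist.2 h₂)

theorem pair_sublist_mem {a b : α} {X : List α} (h : [a, b].Sublist X) : a ∈ X ∧ b ∈ X :=
  ⟨h.subset (by simp), h.subset (by simp)⟩

theorem pair_sublist_ne {a b : α} {X : List α} (hX : X.Nodup) (h : [a, b].Sublist X) : a ≠ b := by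
  simpa using hX.sublist h

theorem pair_sublist_asymm {a b : α} {X : List α} (hX : X.Nodup) (h : [a, b].Sublist X)
    (h' : [b, a].Sublist X) : False := by
  induction X with
  | nil => simp at h
  | cons c X ih =>
    have hne := pair_sublist_ne hX h
    rw [List.nodup_cons] at hX
    rcases List.sublist_cons_iff.1 h with h₁ | ⟨r, h₁, h₂⟩ <;>
      rcases List.sublist_cons_iff.1 h' with h₃ | ⟨r', h₃, h₄⟩
    · exact ih hX.2 h₁ h₃
    · simp only [List.cons.injEq] at h₃
      exact hX.1 (h₃.1 ▸ (pair_sublist_mem h₁).2)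
    · simp only [List.cons.injEq] at h₁
      exact hX.1 (h₁.1 ▸ (pair_sublist_mem h₃).2)
    · simp only [List.cons.injEq] at h₁ h₃
      exact hne (h₁.1.trans h₃.1.symm)

end Lists

theorem mem_edgesFrom {n : ℕ} {j : Fin n} {d : ℕ} {e : Edge n} :
    e ∈ edgesFrom j d ↔ e.1 = some j ∧ e.2 < d := by
  obtain ⟨a, t⟩ := e
  simp only [edgesFrom, List.mem_map, List.mem_range, Prod.mk.injEq]
  constructor
  · rintro ⟨u, hu, rfl, rfl⟩; exact ⟨rfl, hu⟩
  · rintro ⟨rfl, ht⟩; exact ⟨t, ht, rfl, rfl⟩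

theorem nodup_edgesFrom {n : ℕ} (j : Fin n) (d : ℕ) : (edgesFrom j d).Nodup :=
  List.nodup_range.map fun _ _ h => by simpa using h

theorem pair_sublist_edgesFrom {n : ℕ} {j : Fin n} {d : ℕ} {e f : Edge n} :
    [e, f].Sublist (edgesFrom j d) ↔ e.1 = some j ∧ f.1 = some j ∧ e.2 < f.2 ∧ f.2 < d := by
  have key : ∀ t u, t < u → u < d → [((some j, t) : Edge n), (some j, u)].Sublist (edgesFrom j d) := by
    intro t u htu hu
    have : [t, u].Sublist (List.range d) := by
      rw [List.range_eq_range', ← Nat.sub_add_cancel (Nat.le_of_lt_succ (Nat.lt_succ_of_lt htu)),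
        Nat.sub_add_cancel htu.le]
      have h := List.range'_append (s := 0) (m := u) (n := d - u) (step := 1)
      rw [show u + (d - u) = d by omega] at h
      rw [← h]
      exact pair_sublist_append.2 (.inr (.inr ⟨by simp; omega, by simp; omega⟩))
    exact this.map fun t => ((some j, t) : Edge n)
  constructor
  · intro h
    obtain ⟨he, hf⟩ := pair_sublist_mem h
    rw [mem_edgesFrom] at he hf
    refine ⟨he.1, hf.1, ?_, hf.2⟩
    by_contra hlt
    have hne := pair_sublist_ne (nodup_edgesFrom j d) h
    have hne' : e.2 ≠ f.2 := fun h => hne (Prod.ext (he.1.trans hf.1.symm) h)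
    refine pair_sublist_asymm (nodup_edgesFrom j d) h ?_
    have := key f.2 e.2 (by omega) he.2
    rwa [← he.1, show (e.1, e.2) = e from rfl, he.1, ← hf.1] at this
  · obtain ⟨a, t⟩ := e
    obtain ⟨b, u⟩ := f
    rintro ⟨rfl, rfl, h, h'⟩
    exact key _ _ h h'

theorem one_le_numOut (a m : ℕ) : 1 ≤ numOut a m := by
  unfold numOut; split_ifs <;> omega

/-! ### The leaves at successive levels and their order -/

namespace Bush

variable {n : ℕ} {s : Fin n → ℕ} {B : Bush n}

theorem level_induction {P : ℕ → Prop} (h0 : P 0) (hs : ∀ k : Fin n, P k → P (k + 1)) :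
    ∀ k ≤ n, P k := by
  intro k
  induction k with
  | zero => exact fun _ => h0
  | succ k ih => exact fun h => hs ⟨k, h⟩ (ih (by omega))

/-- The edge `e` is to the left of the edge `f` at level `k`. -/
def Bef (B : Bush n) (k : ℕ) (e f : Edge n) : Prop := [e, f].Sublist (B.front k)

namespace IsSBush

theorem one_le_out (hB : B.IsSBush s) (j : Fin n) : 1 ≤ B.out j := by
  rw [(hB j).2.2]; exact one_le_numOut _ _

theorem inc_cases (hB : B.IsSBush s) (j : Fin n) : (∃ e, B.inc j = [e]) ∨ ∃ f e, B.inc j = [f, e] := by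
  rcases (hB j).2.1 with h | h
  · exact .inl (List.length_eq_one_iff.1 h)
  · exact .inr (List.length_eq_two.1 h)

theorem inc_ne_nil (hB : B.IsSBush s) (j : Fin n) : B.inc j ≠ [] := by
  rcases hB.inc_cases j with ⟨e, h⟩ | ⟨f, e, h⟩ <;> simp [h]

theorem mem_front_of_mem_inc (hB : B.IsSBush s) {j : Fin n} {e : Edge n} (h : e ∈ B.inc j) :
    e ∈ B.front j := (hB j).1.subset h

/-- Without duplicates, the `flatMap` in `front` is a single substitution: the head of `B.inc k`
occurs once, a second incoming edge is erased, all other edges are kept. The absence of duplicates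
is a hypothesis because `front_aux` derives it inductively from this lemma. -/
theorem front_succ_of_nodup (hB : B.IsSBush s) (k : Fin n) (hnd : (B.front k).Nodup) :
    ∃ A C, B.front k = A ++ B.inc k ++ C ∧
      B.front (k + 1) = A ++ edgesFrom k (B.out k) ++ C := by
  obtain ⟨A, C, h⟩ := (hB k).1
  refine ⟨A, C, h.symm, ?_⟩
  have hs : B.front (k + 1) = (B.front k).flatMap fun e =>
        if (B.inc k).head? = some e then edgesFrom k (B.out k)
        else if e ∈ B.inc k then [] else [e] := by
    rw [front, dif_pos k.2]
  rw [← h] at hnd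
  rw [hs, ← h, List.flatMap_append, List.flatMap_append]
  have hA : ∀ X : List (Edge n), (∀ e ∈ X, e ∉ B.inc k) → (X.flatMap fun e =>
        if (B.inc k).head? = some e then edgesFrom k (B.out k)
        else if e ∈ B.inc k then [] else [e]) = X := by
    intro X hX
    induction X with
    | nil => rfl
    | cons e X ih =>
      have he := hX e (by simp)
      rw [List.flatMap_cons, ih fun e he => hX e (by simp [he]), if_neg, if_neg he]
      · rfl
      · exact fun h => he (List.mem_of_mem_head? (by simp [h]))
  rw [hA A, hA C]
  · congr 2
    rcases hB.inc_cases k with ⟨e, h'⟩ | ⟨f, e, h'⟩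
    · simp [h']
    · have : f ≠ e := by
        rintro rfl
        rw [h'] at hnd
        simp [List.nodup_append] at hnd
      simp [h', this]
  · intro e he h'
    simp only [List.nodup_append, List.mem_append] at hnd
    exact hnd.2.2 e (.inr h') e he rfl
  · intro e he h'
    simp only [List.nodup_append, List.mem_append] at hnd
    exact hnd.1.2.2 e he e h' rfl

/-- A joint induction is needed: the edges leaving `k` are new because all edges already present
have smaller sources. -/
theorem front_aux (hB : B.IsSBush s) : ∀ k ≤ n, (B.front k).Nodup ∧
    ∀ a t, (some a, t) ∈ B.front k → (a : ℕ) < k ∧ t < B.out a := by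
  refine level_induction ⟨by simp [front], by simp [front]⟩ fun k ⟨hnd, hlt⟩ => ?_
  obtain ⟨A, C, h, h'⟩ := hB.front_succ_of_nodup k hnd
  rw [h] at hnd hlt
  rw [h']
  have hk : ∀ X : List (Edge n), (∀ e ∈ X, e ∈ A ++ B.inc k ++ C) →
      ∀ e ∈ X, ∀ f ∈ edgesFrom k (B.out k), e ≠ f := by
    rintro X hX e he _ hf rfl
    obtain ⟨a, t⟩ := e
    rw [mem_edgesFrom] at hf
    obtain ⟨rfl, _⟩ := hf
    exact lt_irrefl _ (hlt _ _ (hX _ he)).1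
  constructor
  · simp only [List.nodup_append, List.mem_append] at hnd ⊢
    refine ⟨⟨hnd.1.1, nodup_edgesFrom _ _, hk A (by simp +contextual)⟩, hnd.2.1, ?_⟩
    rintro e (he | he) f hf
    · exact hnd.2.2 e (.inl he) f hf
    · exact (hk C (by simp +contextual) f hf e he).symm
  · intro a t ha
    simp only [List.mem_append, mem_edgesFrom, Option.some.injEq] at ha
    rcases ha with (ha | ⟨rfl, ha⟩) | ha
    · have := hlt a t (by simp [ha]); exact ⟨by omega, this.2⟩
    · exact ⟨by omega, ha⟩
    · have := hlt a t (by simp [ha]); exact ⟨by omega, this.2⟩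

theorem nodup_front (hB : B.IsSBush s) {k : ℕ} (hk : k ≤ n) : (B.front k).Nodup :=
  (hB.front_aux k hk).1

theorem lt_of_mem_front (hB : B.IsSBush s) {k : ℕ} (hk : k ≤ n) {a : Fin n} {t : ℕ}
    (h : (some a, t) ∈ B.front k) : (a : ℕ) < k := ((hB.front_aux k hk).2 a t h).1

theorem lt_out_of_mem_front (hB : B.IsSBush s) {k : ℕ} (hk : k ≤ n) {a : Fin n} {t : ℕ}
    (h : (some a, t) ∈ B.front k) : t < B.out a := ((hB.front_aux k hk).2 a t h).2

theorem lt_of_mem_inc (hB : B.IsSBush s) {j a : Fin n} {t : ℕ} (h : (some a, t) ∈ B.inc j) :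
    a < j := hB.lt_of_mem_front j.2.le (hB.mem_front_of_mem_inc h)

theorem fst_ne_of_mem_front (hB : B.IsSBush s) {k : Fin n} {e : Edge n} (h : e ∈ B.front k) :
    e.1 ≠ some k := by
  obtain ⟨a, t⟩ := e
  rintro rfl
  exact lt_irrefl _ (hB.lt_of_mem_front k.2.le h)

theorem front_split (hB : B.IsSBush s) (k : Fin n) :
    ∃ A C, B.front k = A ++ B.inc k ++ C ∧ B.front (k + 1) = A ++ edgesFrom k (B.out k) ++ C :=
  hB.front_succ_of_nodup k (hB.nodup_front k.2.le)

theorem nodup_inc (hB : B.IsSBush s) (k : Fin n) : (B.inc k).Nodup :=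
  (hB.nodup_front k.2.le).sublist (hB k).1.sublist

theorem mem_front_succ (hB : B.IsSBush s) (k : Fin n) {e : Edge n} : e ∈ B.front (k + 1) ↔
    (e.1 = some k ∧ e.2 < B.out k) ∨ (e.1 ≠ some k ∧ e ∈ B.front k ∧ e ∉ B.inc k) := by
  obtain ⟨A, C, h, h'⟩ := hB.front_split k
  have hnd := hB.nodup_front k.2.le
  have hne := fun e => hB.fst_ne_of_mem_front (k := k) (e := e)
  rw [h] at hnd hne
  rw [h, h']
  simp only [List.nodup_append, List.mem_append] at hnd hne
  simp only [List.mem_append, mem_edgesFrom]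
  have h1 : e ∈ A → e ∉ B.inc k := fun h h' => hnd.1.2.2 e h e h' rfl
  have h2 : e ∈ C → e ∉ B.inc k := fun h h' => hnd.2.2 e (.inr h') e h rfl
  have h3 := hne e
  tauto

/-- The relative positions of two edges after the insertion of the node `k`. -/
theorem bef_succ (hB : B.IsSBush s) (k : Fin n) {e f : Edge n} : B.Bef (k + 1) e f ↔
    (e.1 = some k ∧ f.1 = some k ∧ e.2 < f.2 ∧ f.2 < B.out k) ∨
    (e.1 = some k ∧ e.2 < B.out k ∧ f.1 ≠ some k ∧ f ∉ B.inc k ∧ ∀ a ∈ B.inc k, B.Bef k a f) ∨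
    (f.1 = some k ∧ f.2 < B.out k ∧ e.1 ≠ some k ∧ e ∉ B.inc k ∧ ∀ a ∈ B.inc k, B.Bef k e a) ∨
    (e.1 ≠ some k ∧ f.1 ≠ some k ∧ e ∉ B.inc k ∧ f ∉ B.inc k ∧ B.Bef k e f) := by
  obtain ⟨A, C, h, h'⟩ := hB.front_split k
  have hnd := hB.nodup_front k.2.le
  have hne := fun e => hB.fst_ne_of_mem_front (k := k) (e := e)
  unfold Bef
  rw [h] at hnd hne
  rw [h, h']
  simp only [List.nodup_append, List.mem_append] at hnd hne
  simp only [pair_sublist_append, List.mem_append, mem_edgesFrom, pair_sublist_edgesFrom]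
  have h1 : ∀ e, e ∈ A → e ∉ B.inc k := fun e h h' => hnd.1.2.2 e h e h' rfl
  have h2 : ∀ e, e ∈ C → e ∉ B.inc k := fun e h h' => hnd.2.2 e (.inr h') e h rfl
  have h3 : ∀ e, e ∈ A → e ∉ C := fun e h h' => hnd.2.2 e (.inl h) e h' rfl
  have hA : ∀ {e f : Edge n}, [e, f].Sublist A → e ∈ A ∧ f ∈ A := pair_sublist_mem
  have hC : ∀ {e f : Edge n}, [e, f].Sublist C → e ∈ C ∧ f ∈ C := pair_sublist_mem
  have hI : ∀ {e f : Edge n}, [e, f].Sublist (B.inc k) → e ∈ B.inc k ∧ f ∈ B.inc k :=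
    pair_sublist_mem
  -- A witness is needed to turn a condition on all incoming edges into a position relative to the
  -- block `B.inc k`; it would be void for an empty block.
  obtain ⟨a, ha⟩ := List.exists_mem_of_ne_nil _ (hB.inc_ne_nil k)
  constructor
  · rintro (((h | h | h) | h | h))
    all_goals grind
  · rintro (h | ⟨h, h', h'', h3, h4⟩ | ⟨h, h', h'', h3, h4⟩ | h)
    · grind
    · have := h4 a ha
      grind
    · have := h4 a ha
      grind
    · grind

end IsSBush
/-- The order of the edges at level `k`, seen from the side `d`. -/
def BefSide (B : Bush n) : Side → ℕ → Edge n → Edge n → Prop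
  | .left, k, e, f => B.Bef k e f
  | .right, k, e, f => B.Bef k f e

/-- The incoming edge of `k` on the side `d`. -/
def near (B : Bush n) : Side → Fin n → Option (Edge n)
  | .left, k => (B.inc k).head?
  | .right, k => (B.inc k).getLast?

/-- The edge `e` lies to the left of the node `k`. -/
def Ahead (B : Bush n) (k : Fin n) (e : Edge n) : Prop := ∃ f ∈ B.inc k, B.Bef k e f

end Bush

/-! ### Symbolic gap labels -/

/-- A symbolic gap label: the gap next to which node it was created, its initial second entry, and what has
been added to it. -/
structure Tag (n : ℕ) where
  node : Fin n
  start : ℕ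
  shift : ℕ

/-- The effect of adding `c` to the second entry of a label. -/
def Tag.push {n : ℕ} (c : ℕ) (g : Tag n) : Tag n := ⟨g.node, g.start, g.shift + c⟩

/-- The value of a label. -/
def Tag.val {n : ℕ} (x : Fin n → ℝ) (g : Tag n) : ℝ := x g.node - (g.start + g.shift : ℕ)

/-- The increment of the label on the side `d` of the `d`-most leaf of a new node. -/
def Side.gain : Side → ℕ → ℕ
  | .left, c => c
  | .right, _ => 0

/-- The second entry, at its creation, of the label on the side `d` of the edge of position `t` of a node
with `m` outgoing edges. -/
def Side.start : Side → ℕ → ℕ → ℕ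
  | .left, m, t => m - 1 - t
  | .right, m, t => m - 2 - t

namespace Bush

variable {n : ℕ} {s : Fin n → ℕ} {B : Bush n}

open Classical in
/-- The label on the side `d` of the leaf `e` before the insertion of the node of index `k`. -/
noncomputable def tag (s : Fin n → ℕ) (B : Bush n) : ℕ → Side → Edge n → Option (Tag n)
  | 0, _, _ => none
  | k + 1, d, e =>
    if h : k < n then
      if e.1 = some ⟨k, h⟩ then
        if e = B.exit d ⟨k, h⟩ then
          (B.near d ⟨k, h⟩).bind fun f => (B.tag s k d f).map (Tag.push (d.gain (s ⟨k, h⟩ - 1)))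
        else some ⟨⟨k, h⟩, d.start (B.out ⟨k, h⟩) e.2, 0⟩
      else (B.tag s k d e).map (Tag.push (if B.Ahead ⟨k, h⟩ e then s ⟨k, h⟩ - 1 else 0))
    else B.tag s k d e

theorem tag_exit (k : Fin n) {d : Side} {f : Edge n} (hf : B.near d k = some f) :
    B.tag s (k + 1) d (B.exit d k) = (B.tag s k d f).map (Tag.push (d.gain (s k - 1))) := by
  have h : (B.exit d k).1 = some k := by cases d <;> rfl
  rw [tag, dif_pos k.2, if_pos h, if_pos rfl, hf]
  rfl

theorem tag_new (k : Fin n) {d : Side} {t : ℕ} (h : (some k, t) ≠ B.exit d k) :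
    B.tag s (k + 1) d (some k, t) = some ⟨k, d.start (B.out k) t, 0⟩ := by
  rw [tag, dif_pos k.2, if_pos rfl, if_neg h]

open Classical in
theorem tag_old (k : Fin n) {d : Side} {e : Edge n} (h : e.1 ≠ some k) :
    B.tag s (k + 1) d e =
      (B.tag s k d e).map (Tag.push (if B.Ahead k e then s k - 1 else 0)) := by
  rw [tag, dif_pos k.2, if_neg h]

theorem exit_fst (d : Side) (k : Fin n) : (B.exit d k).1 = some k := by cases d <;> rfl

namespace IsSBush

theorem exists_near (hB : B.IsSBush s) (d : Side) (k : Fin n) : ∃ e, B.near d k = some e := by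
  rcases hB.inc_cases k with ⟨e, h⟩ | ⟨f, e, h⟩ <;> cases d <;> simp [near, h]

theorem near_iff (hB : B.IsSBush s) {d : Side} {k : Fin n} {e : Edge n} :
    B.near d k = some e ↔ e ∈ B.inc k ∧ ¬ B.Crosses d e k := by
  have hnd := hB.nodup_inc k
  rcases hB.inc_cases k with ⟨e', h⟩ | ⟨f, e', h⟩ <;> rw [h] at hnd <;> cases d <;>
    simp only [near, Crosses, h] <;> grind

theorem near_mem (hB : B.IsSBush s) {d : Side} {k : Fin n} {e : Edge n} (h : B.near d k = some e) :
    e ∈ B.inc k := (hB.near_iff.1 h).1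

/-- The incoming edges of a node are ordered. -/
theorem near_befSide (hB : B.IsSBush s) {d : Side} {k : Fin n} {e f : Edge n}
    (h : B.near d k = some e) (hf : f ∈ B.inc k) : e = f ∨ B.BefSide d k e f := by
  have hs := (hB k).1.sublist
  rcases hB.inc_cases k with ⟨e', h'⟩ | ⟨f', e', h'⟩ <;> rw [h'] at hf hs
  · cases d <;> simp_all [near]
  · cases d <;> simp [near, h'] at h <;> subst h <;> simp at hf <;> rcases hf with rfl | rfl
    · exact .inl rfl
    · exact .inr hs
    · exact .inr hs
    · exact .inl rfl

/-- A leaf disappears when a node is attached to it. -/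
theorem not_mem_front_of_mem_inc (hB : B.IsSBush s) {m : Fin n} {e : Edge n} (h : e ∈ B.inc m) :
    ∀ k ≤ n, (m : ℕ) < k → e ∉ B.front k := by
  refine level_induction (by simp) fun k ih hmk => ?_
  have he := hB.mem_front_of_mem_inc h
  rw [hB.mem_front_succ]
  rintro (⟨h1, -⟩ | ⟨-, h1, h2⟩)
  · obtain ⟨a, t⟩ := e
    simp only at h1
    subst h1
    have := hB.lt_of_mem_front m.2.le he
    omega
  · rcases (Nat.lt_succ_iff_lt_or_eq.1 hmk) with h3 | h3
    · exact ih h3 h1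
    · rw [Fin.ext h3] at h
      exact h2 h

/-- A leaf to which a node is attached never reappears at a later level, so an edge has only one
end. -/
theorem inc_unique (hB : B.IsSBush s) {m k : Fin n} {e : Edge n} (h : e ∈ B.inc m)
    (h' : e ∈ B.inc k) : m = k := by
  rcases lt_trichotomy m k with h1 | h1 | h1
  · exact absurd (hB.mem_front_of_mem_inc h') (hB.not_mem_front_of_mem_inc h k k.2.le h1)
  · exact h1
  · exact absurd (hB.mem_front_of_mem_inc h) (hB.not_mem_front_of_mem_inc h' m m.2.le h1)

end IsSBush

/-! ### Backward paths and the entries of labels -/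

/-- `p` is an increasing path that starts with an outgoing edge of `i` and ends with the edge `e`. -/
inductive Trail (B : Bush n) (i : Fin n) : Edge n → List (Edge n) → Prop
  | single (t : ℕ) : Trail B i (some i, t) [(some i, t)]
  | snoc {e : Edge n} {p : List (Edge n)} {k : Fin n} (t : ℕ) : Trail B i e p → e ∈ B.inc k →
      Trail B i (some k, t) (p ++ [(some k, t)])

/-- A trail that starts with the edge of position `t` of `i` and is then, read backwards, the extreme
one on the side `d`, always leaving through the extreme edge on the side `d`. -/
inductive SideTrail (B : Bush n) (d : Side) (i : Fin n) (t : ℕ) : Edge n → List (Edge n) → Prop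
  | single : (some i, t) ≠ B.exit d i → SideTrail B d i t (some i, t) [(some i, t)]
  | snoc {e : Edge n} {p : List (Edge n)} {k : Fin n} : SideTrail B d i t e p →
      B.near d k = some e → SideTrail B d i t (B.exit d k) (p ++ [B.exit d k])

theorem Trail.exists_fst {i : Fin n} {e : Edge n} {p : List (Edge n)} (h : B.Trail i e p) :
    ∃ k t, e = (some k, t) := by
  cases h <;> exact ⟨_, _, rfl⟩

theorem Trail.getLast?_eq {i : Fin n} {e : Edge n} {p : List (Edge n)} (h : B.Trail i e p) :
    p.getLast? = some e := by
  cases h <;> simp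

theorem SideTrail.trail (hB : B.IsSBush s) {d : Side} {i : Fin n} {t : ℕ} {e : Edge n}
    {p : List (Edge n)} (h : B.SideTrail d i t e p) : B.Trail i e p := by
  induction h with
  | single h => exact .single t
  | @snoc e p k h hk ih =>
    have := ih.snoc (k := k) (B.exit d k).2 (hB.near_mem hk)
    rwa [← exit_fst (B := B) d k] at this

theorem SideTrail.exists_cons {d : Side} {i : Fin n} {t : ℕ} {e : Edge n}
    {p : List (Edge n)} (h : B.SideTrail d i t e p) : (some i, t) ≠ B.exit d i ∧
      ∃ q, p = (some i, t) :: q ∧ ∀ f ∈ q, B.IsExit d f := by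
  induction h with
  | single h => exact ⟨h, [], rfl, by simp⟩
  | @snoc e p k h hk ih =>
    obtain ⟨h', q, rfl, hq⟩ := ih
    refine ⟨h', q ++ [B.exit d k], rfl, ?_⟩
    intro f hf
    rcases List.mem_append.1 hf with hf | hf
    · exact hq f hf
    · exact ⟨k, by simpa using hf⟩

theorem Trail.le_fst (hB : B.IsSBush s) {i : Fin n} {e : Edge n} {p : List (Edge n)}
    (h : B.Trail i e p) : ∀ k t, e = (some k, t) → i ≤ k := by
  induction h with
  | single t => rintro k t ⟨⟩; exact le_rfl
  | @snoc e p k t h hk ih =>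
    rintro k' t' ⟨⟩
    obtain ⟨a, u, rfl⟩ := h.exists_fst
    exact (ih a u rfl).trans (hB.lt_of_mem_inc hk).le

theorem Trail.eq_single (hB : B.IsSBush s) {i : Fin n} {t : ℕ} {p : List (Edge n)}
    (h : B.Trail i (some i, t) p) : p = [(some i, t)] := by
  cases h with
  | single t => rfl
  | snoc t h hk =>
    obtain ⟨a, u, rfl⟩ := h.exists_fst
    exact absurd (hB.lt_of_mem_inc hk) (h.le_fst hB a u rfl).not_gt

theorem Trail.exists_snoc {i k : Fin n} {t : ℕ} {p : List (Edge n)}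
    (h : B.Trail i (some k, t) p) (hik : i ≠ k) :
    ∃ e q, e ∈ B.inc k ∧ B.Trail i e q ∧ p = q ++ [(some k, t)] := by
  cases h with
  | single t => exact absurd rfl hik
  | snoc t h hk => exact ⟨_, _, hk, h, rfl⟩

/-- Sources strictly increase along a trail, so an edge that leaves `i` itself can only be the first
one; comparing `i` and `k` decides between the constructors. -/
theorem SideTrail.cases_fst (hB : B.IsSBush s) {d : Side} {i k : Fin n} {t u : ℕ} {p : List (Edge n)}
    (h : B.SideTrail d i t (some k, u) p) :
    (i = k ∧ t = u ∧ p = [(some i, t)] ∧ (some i, t) ≠ B.exit d i) ∨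
    (i ≠ k ∧ (some k, u) = B.exit d k ∧ ∃ e q, B.near d k = some e ∧ B.SideTrail d i t e q ∧
      p = q ++ [(some k, u)]) := by
  generalize he : ((some k, u) : Edge n) = e at h
  cases h with
  | single h => 
    cases he
    exact .inl ⟨rfl, rfl, rfl, h⟩
  | @snoc e p k' h hk =>
    have : some k = some k' := (congrArg Prod.fst he).trans (exit_fst _ _)
    cases this
    refine .inr ⟨?_, rfl, e, p, hk, h, rfl⟩
    rintro rfl
    have h' := h.trail hB
    obtain ⟨a, v, rfl⟩ := h'.exists_fst
    exact absurd (hB.lt_of_mem_inc (hB.near_mem hk)) (h'.le_fst hB a v rfl).not_gt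

theorem Trail.mem_inc (hB : B.IsSBush s) {i : Fin n} {e : Edge n} {p : List (Edge n)}
    (h : B.Trail i e p) : ∀ k t, e = (some k, t) → ∀ f ∈ p, f ≠ e → ∃ m ≤ k, f ∈ B.inc m := by
  induction h with
  | single t => rintro k t ⟨⟩ f hf hne; simp at hf; exact absurd hf hne
  | @snoc e p k t h hk ih =>
    rintro k' t' ⟨⟩ f hf hne
    obtain ⟨a, u, rfl⟩ := h.exists_fst
    simp only [List.mem_append, List.mem_singleton, hne, or_false] at hf
    by_cases hfe : f = (some a, u)
    · exact ⟨k, le_rfl, hfe ▸ hk⟩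
    · obtain ⟨m, hm, h⟩ := ih a u rfl f hf hfe
      exact ⟨m, hm.trans (hB.lt_of_mem_inc hk).le, h⟩

/-- Among the edges of a trail, only the last one is present at a level that it reaches. -/
theorem Trail.eq_of_mem_front (hB : B.IsSBush s) {i : Fin n} {e f : Edge n} {p : List (Edge n)}
    (h : B.Trail i e p) {k : ℕ} (hk : k ≤ n) (he : e ∈ B.front k) (hf : f ∈ p)
    (hfk : f ∈ B.front k) : f = e := by
  by_contra hne
  obtain ⟨a, t, rfl⟩ := h.exists_fst
  obtain ⟨m, hm, hfm⟩ := h.mem_inc hB a t rfl f hf hne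
  have := hB.lt_of_mem_front hk he
  exact hB.not_mem_front_of_mem_inc hfm k hk (by omega) hfk

theorem Trail.mem {i : Fin n} {e : Edge n} {p : List (Edge n)}
    (h : B.Trail i e p) : e ∈ p := List.mem_of_mem_getLast? h.getLast?_eq

theorem Trail.onPath_iff (hB : B.IsSBush s) {i : Fin n} {e : Edge n} {p : List (Edge n)}
    (h : B.Trail i e p) {k : Fin n} (he : e ∈ B.front k) : B.OnPath p k ↔ e ∈ B.inc k := by
  constructor
  · rintro ⟨f, hf, hfk⟩
    rwa [← h.eq_of_mem_front hB k.2.le he hf (hB.mem_front_of_mem_inc hfk)]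
  · exact fun h' => ⟨e, h.mem, h'⟩

/-- A trail has only one edge among the leaves of a level reached by its last edge, so being to the
right of the path is a comparison with that edge. -/
theorem Trail.rightOf_iff (hB : B.IsSBush s) {i : Fin n} {e : Edge n} {p : List (Edge n)}
    (h : B.Trail i e p) {k : Fin n} (he : e ∈ B.front k) :
    B.RightOf p k ↔ e ∉ B.inc k ∧ B.Ahead k e := by
  unfold RightOf Ahead
  rw [h.onPath_iff hB he]
  refine and_congr_right fun _ => ⟨?_, ?_⟩
  · rintro ⟨f, hf, g, hg, hfg⟩
    rw [h.eq_of_mem_front hB k.2.le he hf (pair_sublist_mem hfg).1] at hfg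
    exact ⟨g, hg, hfg⟩
  · rintro ⟨f, hf, hef⟩
    exact ⟨e, h.mem, f, hf, hef⟩

/-- The node `k` contributes to the right-hand side given by the path `p`. -/
def Counts (B : Bush n) : Side → List (Edge n) → Fin n → Prop
  | .left, p, k => B.OnPath p k ∨ B.RightOf p k
  | .right, p, k => B.RightOf p k

/-- An edge leaving `k` is not yet present at a level `m ≤ k`, so it cannot change what is counted
there. -/
theorem counts_snoc (hB : B.IsSBush s) {d : Side} {p : List (Edge n)} {k m : Fin n} {t : ℕ}
    (hm : m ≤ k) : B.Counts d (p ++ [(some k, t)]) m ↔ B.Counts d p m := by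
  have h0 : ((some k, t) : Edge n) ∉ B.front m := fun h => by
    have := hB.lt_of_mem_front m.2.le h
    omega
  have h1 : B.OnPath (p ++ [(some k, t)]) m ↔ B.OnPath p m := by
    constructor
    · rintro ⟨e, he, hem⟩
      rcases List.mem_append.1 he with he | he
      · exact ⟨e, he, hem⟩
      · rw [List.mem_singleton.1 he] at hem
        exact absurd (hB.mem_front_of_mem_inc hem) h0
    · rintro ⟨e, he, hem⟩
      exact ⟨e, List.mem_append_left _ he, hem⟩
  have h2 : B.RightOf (p ++ [(some k, t)]) m ↔ B.RightOf p m := by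
    unfold RightOf
    rw [h1]
    refine and_congr_right fun _ => ⟨?_, ?_⟩
    · rintro ⟨e, he, f, hf, hef⟩
      rcases List.mem_append.1 he with he | he
      · exact ⟨e, he, f, hf, hef⟩
      · rw [List.mem_singleton.1 he] at hef
        exact absurd (pair_sublist_mem hef).1 h0
    · rintro ⟨e, he, f, hf, hef⟩
      exact ⟨e, List.mem_append_left _ he, f, hf, hef⟩
  cases d
  · exact or_congr h1 h2
  · exact h2

open Classical in
/-- `weight` up to an arbitrary level. -/
noncomputable def levelWeight (s : Fin n → ℕ) (i : Fin n) (k : ℕ) (R : Fin n → Prop) : ℤ :=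
  ∑ m ∈ Finset.univ.filter (fun m => i < m ∧ (m : ℕ) < k ∧ R m), max 0 ((s m : ℤ) - 1)

theorem levelWeight_coe (i j : Fin n) (R : Fin n → Prop) :
    levelWeight s i j R = weight s i j R := rfl

theorem levelWeight_self (i : Fin n) (R : Fin n → Prop) : levelWeight s i (i + 1) R = 0 := by
  classical
  unfold levelWeight
  rw [Finset.filter_false_of_mem, Finset.sum_empty]
  intro m _ h
  have := h.1
  omega

open Classical in
theorem levelWeight_succ {i k : Fin n} (hik : i < k) (R : Fin n → Prop) :
    levelWeight s i (k + 1) R = levelWeight s i k R + (if R k then ((s k - 1 : ℕ) : ℤ) else 0) := by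
  classical
  unfold levelWeight
  have hc : max 0 ((s k : ℤ) - 1) = ((s k - 1 : ℕ) : ℤ) := by omega
  rw [← hc]
  split_ifs with h
  · rw [show (Finset.univ.filter fun m => i < m ∧ (m : ℕ) < k + 1 ∧ R m) =
      insert k (Finset.univ.filter fun m => i < m ∧ (m : ℕ) < k ∧ R m) by
        ext m
        simp only [Finset.mem_filter, Finset.mem_univ, true_and, Finset.mem_insert]
        constructor
        · rintro ⟨h1, h2, h3⟩
          by_cases h4 : m = k
          · exact .inl h4
          · exact .inr ⟨h1, by omega, h3⟩
        · rintro (rfl | ⟨h1, h2, h3⟩)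
          · exact ⟨hik, by omega, h⟩
          · exact ⟨h1, by omega, h3⟩]
    rw [Finset.sum_insert (by simp), add_comm]
  · rw [add_zero]
    congr 1
    ext m
    simp only [Finset.mem_filter, Finset.mem_univ, true_and]
    constructor
    · rintro ⟨h1, h2, h3⟩
      have h4 : m ≠ k := by rintro rfl; exact h h3
      exact ⟨h1, by omega, h3⟩
    · rintro ⟨h1, h2, h3⟩
      exact ⟨h1, by omega, h3⟩

theorem levelWeight_congr {i : Fin n} {k : ℕ} {R R' : Fin n → Prop}
    (h : ∀ m : Fin n, (m : ℕ) < k → (R m ↔ R' m)) : levelWeight s i k R = levelWeight s i k R' := by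
  classical
  unfold levelWeight
  congr 1
  ext m
  simp only [Finset.mem_filter, Finset.mem_univ, true_and]
  constructor
  · rintro ⟨h1, h2, h3⟩
    exact ⟨h1, h2, (h m h2).1 h3⟩
  · rintro ⟨h1, h2, h3⟩
    exact ⟨h1, h2, (h m h2).2 h3⟩

/-- The label on the side `d` of a leaf, computed from the extreme backward path. -/
theorem SideTrail.tag_eq (hB : B.IsSBush s) {d : Side} {i : Fin n} {t : ℕ} : ∀ k ≤ n,
    ∀ e p, B.SideTrail d i t e p → e ∈ B.front k → ∃ g, B.tag s k d e = some g ∧ g.node = i ∧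
      g.start = d.start (B.out i) t ∧ (g.shift : ℤ) = levelWeight s i k (B.Counts d p) := by
  refine level_induction ?_ ?_
  · intro e p h he
    obtain ⟨a, u, rfl⟩ := (h.trail hB).exists_fst
    simp [front] at he
  · intro k ih e p h he
    have ht := h.trail hB
    rcases (hB.mem_front_succ k).1 he with ⟨h1, h2⟩ | ⟨h1, h2, h3⟩
    · obtain ⟨a, u⟩ := e
      simp only at h1 h2
      subst h1
      rcases h.cases_fst hB with ⟨rfl, rfl, rfl, h3⟩ | ⟨h3, h4, f, q, h5, h6, rfl⟩
      · exact ⟨_, tag_new i h3, rfl, rfl, by rw [levelWeight_self]; rfl⟩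
      · have hfk := hB.mem_front_of_mem_inc (hB.near_mem h5)
        obtain ⟨g, hg, hgi, hgs, hgw⟩ := ih f q h6 hfk
        have hq := h6.trail hB
        refine ⟨g.push (d.gain (s k - 1)), by rw [h4, tag_exit k h5, hg]; rfl, hgi, hgs, ?_⟩
        have hlt : i < k := lt_of_le_of_ne (ht.le_fst hB k u rfl) h3
        rw [levelWeight_succ hlt, levelWeight_congr (R' := B.Counts d q)
          fun m hm => counts_snoc hB hm.le]
        have hon : B.OnPath q k := (hq.onPath_iff hB hfk).2 (hB.near_mem h5)
        -- The node `k` is on the path. It counts weakly but not strictly, just as the label is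
        -- pushed by `k` on the left of its leaves and not on their right.
        have hc : B.Counts d (q ++ [(some k, u)]) k ↔ d = .left := by
          rw [counts_snoc hB le_rfl]
          cases d
          · simp [Counts, hon]
          · simp [Counts, RightOf, hon]
        cases d
        · rw [if_pos (hc.2 rfl)]
          simp [Tag.push, Side.gain, hgw]
        · rw [if_neg fun h => by cases hc.1 h]
          simp [Tag.push, Side.gain, hgw]
    · obtain ⟨g, hg, hgi, hgs, hgw⟩ := ih e p h h2
      classical
      refine ⟨g.push (if B.Ahead k e then s k - 1 else 0), by rw [tag_old k h1, hg]; rfl, hgi, hgs, ?_⟩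
      obtain ⟨a, u, rfl⟩ := ht.exists_fst
      have hlt : i < k := lt_of_le_of_lt (ht.le_fst hB a u rfl) (hB.lt_of_mem_front k.2.le h2)
      have hc : B.Counts d p k ↔ B.Ahead k (some a, u) := by
        cases d <;> simp [Counts, ht.onPath_iff hB h2, ht.rightOf_iff hB h2, h3]
      rw [levelWeight_succ hlt]
      simp only [hc, Tag.push, Nat.cast_add, hgw]
      split_ifs <;> simp

/-- Every label comes from an extreme backward path. -/
theorem exists_sideTrail (hB : B.IsSBush s) {d : Side} : ∀ k ≤ n, ∀ e ∈ B.front k,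
    ∀ g, B.tag s k d e = some g → ∃ t p, B.SideTrail d g.node t e p := by
  refine level_induction ?_ ?_
  · intro e he g hg
    simp [tag] at hg
  · intro k ih e he g hg
    rcases (hB.mem_front_succ k).1 he with ⟨h1, h2⟩ | ⟨h1, h2, h3⟩
    · obtain ⟨a, u⟩ := e
      simp only at h1 h2
      subst h1
      by_cases h : (some k, u) = B.exit d k
      · obtain ⟨f, hf⟩ := hB.exists_near d k
        rw [h, tag_exit k hf, Option.map_eq_some_iff] at hg
        obtain ⟨g', hg', rfl⟩ := hg
        obtain ⟨t, p, hp⟩ := ih f (hB.mem_front_of_mem_inc (hB.near_mem hf)) g' hg'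
        exact ⟨t, _, h ▸ hp.snoc hf⟩
      · rw [tag_new k h] at hg
        cases hg
        exact ⟨u, _, .single h⟩
    · rw [tag_old k h1, Option.map_eq_some_iff] at hg
      obtain ⟨g', hg', rfl⟩ := hg
      exact ih e h2 g' hg'

/-! ### The list of gap labels at each level -/

/-- `G` is the list of the gap labels before the insertion of the node of index `k`. -/
def IsGaps (s : Fin n → ℕ) (B : Bush n) (k : ℕ) (G : List (Tag n)) : Prop :=
  (B.front k).map (B.tag s k .left) = none :: G.map some ∧
    (B.front k).map (B.tag s k .right) = G.map some ++ [none]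

/-- The gap labels after the insertion of a node `k` with `d` outgoing edges that is attached to `m`
leaves, with `a` leaves on its left. -/
def nextGaps (s : Fin n → ℕ) (k : Fin n) (G : List (Tag n)) (a m d : ℕ) : List (Tag n) :=
  (G.take a).map (Tag.push (s k - 1)) ++ (List.range (d - 1)).reverse.map (fun t => ⟨k, t, 0⟩) ++
    G.drop (a + m - 1)

theorem map_start_left (k : Fin n) (d : ℕ) :
    (List.range (d - 1)).map (fun t => (⟨k, Side.left.start d (t + 1), 0⟩ : Tag n)) =
      (List.range (d - 1)).reverse.map (fun t => ⟨k, t, 0⟩) := by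
  refine List.ext_getElem (by simp) fun i h1 h2 => ?_
  simp only [List.length_map, List.length_range] at h1
  simp only [List.getElem_map, List.getElem_range, List.getElem_reverse, List.length_range, Side.start]
  congr 1
  omega

theorem map_start_right (k : Fin n) (d : ℕ) :
    (List.range (d - 1)).map (fun t => (⟨k, Side.right.start d t, 0⟩ : Tag n)) =
      (List.range (d - 1)).reverse.map (fun t => ⟨k, t, 0⟩) := by
  refine List.ext_getElem (by simp) fun i h1 h2 => ?_
  simp only [List.length_map, List.length_range] at h1
  simp only [List.getElem_map, List.getElem_range, List.getElem_reverse, List.length_range, Side.start]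
  congr 1

theorem map_tag_edgesFrom_left (k : Fin n) (h : 1 ≤ B.out k) :
    (edgesFrom k (B.out k)).map (B.tag s (k + 1) .left) =
      B.tag s (k + 1) .left (B.exit .left k) ::
        ((List.range (B.out k - 1)).reverse.map (fun t => (⟨k, t, 0⟩ : Tag n))).map some := by
  obtain ⟨d, hd⟩ : ∃ d, B.out k = d + 1 := ⟨B.out k - 1, by omega⟩
  rw [← map_start_left, edgesFrom, hd, List.range_succ_eq_map]
  simp only [List.map_cons, List.map_map, Nat.add_sub_cancel]
  congr 1
  refine List.map_congr_left fun t _ => ?_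
  simp only [Function.comp]
  rw [tag_new k (by simp [exit]), hd]

theorem map_tag_edgesFrom_right (k : Fin n) (h : 1 ≤ B.out k) :
    (edgesFrom k (B.out k)).map (B.tag s (k + 1) .right) =
      ((List.range (B.out k - 1)).reverse.map (fun t => (⟨k, t, 0⟩ : Tag n))).map some ++
        [B.tag s (k + 1) .right (B.exit .right k)] := by
  obtain ⟨d, hd⟩ : ∃ d, B.out k = d + 1 := ⟨B.out k - 1, by omega⟩
  rw [← map_start_right, edgesFrom, hd, List.range_succ]
  simp only [List.map_append, List.map_map, Nat.add_sub_cancel, List.map_cons, List.map_nil]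
  congr 1
  · refine List.map_congr_left fun t ht => ?_
    have ht := List.mem_range.1 ht
    simp only [Function.comp]
    rw [tag_new k (by simp [exit]; omega), hd]
  · simp [exit, hd]

theorem map_tag_old_left (hB : B.IsSBush s) {k : Fin n} {A C : List (Edge n)} {d : Side}
    (h : B.front k = A ++ B.inc k ++ C) :
    A.map (B.tag s (k + 1) d) = (A.map (B.tag s k d)).map (Option.map (Tag.push (s k - 1))) := by
  rw [List.map_map]
  refine List.map_congr_left fun e he => ?_
  have hef : e ∈ B.front k := by rw [h]; simp [he]
  rw [tag_old k (hB.fst_ne_of_mem_front hef), if_pos]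
  · rfl
  · obtain ⟨f, hf⟩ := List.exists_mem_of_ne_nil _ (hB.inc_ne_nil k)
    refine ⟨f, hf, ?_⟩
    unfold Bef
    rw [h]
    simp only [pair_sublist_append]
    exact .inl (.inr (.inr ⟨he, hf⟩))

theorem map_tag_old_right (hB : B.IsSBush s) {k : Fin n} {A C : List (Edge n)} {d : Side}
    (h : B.front k = A ++ B.inc k ++ C) :
    C.map (B.tag s (k + 1) d) = C.map (B.tag s k d) := by
  refine List.map_congr_left fun e he => ?_
  have hef : e ∈ B.front k := by rw [h]; simp [he]
  have hnd := hB.nodup_front k.2.le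
  rw [tag_old k (hB.fst_ne_of_mem_front hef), if_neg]
  · cases B.tag s k d e <;> rfl
  · rintro ⟨f, hf, hef⟩
    refine pair_sublist_asymm hnd hef ?_
    rw [h]
    simp only [pair_sublist_append]
    exact .inr (.inr ⟨by simp [hf], he⟩)

theorem IsGaps.split_left {k : Fin n} {A C : List (Edge n)} {G : List (Tag n)}
    (hG : IsGaps s B k G) (h : B.front k = A ++ B.inc k ++ C) {e : Edge n}
    (he : B.near .left k = some e) :
    A.map (B.tag s k .left) ++ [B.tag s k .left e] = none :: (G.take A.length).map some ∧
      C.map (B.tag s k .left) = (G.drop (A.length + (B.inc k).length - 1)).map some := by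
  obtain ⟨I, hI⟩ : ∃ I, B.inc k = e :: I := List.head?_eq_some_iff.1 he
  have h1 := hG.1
  rw [h, hI] at h1
  simp only [List.map_append, List.map_cons] at h1
  constructor
  · have e1 := congrArg (List.take (A.length + 1)) h1
    rw [List.append_cons, List.append_assoc, List.take_left' (by simp), List.take_succ_cons,
      ← List.map_take] at e1
    exact e1
  · have e2 := congrArg (List.drop (A.length + (I.length + 1))) h1
    rw [List.drop_left' (by simp), ← add_assoc, List.drop_succ_cons, ← List.map_drop] at e2
    rw [hI, List.length_cons, ← add_assoc, Nat.add_sub_cancel, e2]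

theorem IsGaps.split_right {k : Fin n} {A C : List (Edge n)} {G : List (Tag n)}
    (hG : IsGaps s B k G) (h : B.front k = A ++ B.inc k ++ C) {e : Edge n}
    (he : B.near .right k = some e) :
    A.map (B.tag s k .right) = (G.take A.length).map some ∧
      B.tag s k .right e :: C.map (B.tag s k .right) =
        (G.drop (A.length + (B.inc k).length - 1)).map some ++ [none] := by
  obtain ⟨I, hI⟩ : ∃ I, B.inc k = I ++ [e] := List.getLast?_eq_some_iff.1 he
  have h1 := hG.2
  have hlen := congrArg List.length h1
  rw [h, hI] at h1 hlen
  simp only [List.length_map, List.length_append, List.length_cons, List.length_nil] at hlen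
  simp only [List.map_append, List.append_assoc, List.map_cons,
    List.singleton_append] at h1
  constructor
  · have e1 := congrArg (List.take A.length) h1
    rw [List.take_left' (by simp), List.take_append_of_le_length (by simp; omega),
      ← List.map_take] at e1
    exact e1
  · have e2 := congrArg (List.drop (A.length + I.length)) h1
    rw [← List.append_assoc, List.drop_left' (by simp),
      List.drop_append_of_le_length (by simp; omega), ← List.map_drop] at e2
    rw [hI, List.length_append, List.length_singleton, ← add_assoc, Nat.add_sub_cancel, e2]

theorem IsGaps.length {k : ℕ} {G : List (Tag n)} (hG : IsGaps s B k G) :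
    (B.front k).length = G.length + 1 := by
  simpa using congrArg List.length hG.1

theorem isGaps_zero : IsGaps s B 0 [] := ⟨rfl, rfl⟩

/-- The label on the left of the leftmost leaf of `k`, if any, ends the pushed block; the one on the
right of its rightmost leaf, if any, starts the untouched block. If `k` has two incoming edges, the
label between them belongs to neither and disappears. -/
theorem IsGaps.succ (hB : B.IsSBush s) {k : Fin n} {A C : List (Edge n)} {G : List (Tag n)}
    (hG : IsGaps s B k G) (h : B.front k = A ++ B.inc k ++ C)
    (h' : B.front (k + 1) = A ++ edgesFrom k (B.out k) ++ C) :
    IsGaps s B (k + 1) (nextGaps s k G A.length (B.inc k).length (B.out k)) := by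
  constructor
  · obtain ⟨e, he⟩ := hB.exists_near .left k
    obtain ⟨h1, h2⟩ := hG.split_left h he
    rw [h', List.map_append, List.map_append, map_tag_edgesFrom_left k (hB.one_le_out k),
      map_tag_old_left hB h, map_tag_old_right hB h, h2, tag_exit k he]
    have h3 := congrArg (List.map (Option.map (Tag.push (s k - 1)))) h1
    rw [List.map_append, List.map_singleton] at h3
    rw [List.append_cons, show Side.left.gain (s k - 1) = s k - 1 from rfl, h3]
    simp [nextGaps, Function.comp_def]
  · obtain ⟨e, he⟩ := hB.exists_near .right k
    obtain ⟨h1, h2⟩ := hG.split_right h he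
    rw [h', List.map_append, List.map_append, map_tag_edgesFrom_right k (hB.one_le_out k),
      map_tag_old_left hB h, map_tag_old_right hB h, tag_exit k he]
    have h3 : (B.tag s k .right e).map (Tag.push (Side.right.gain (s k - 1))) = B.tag s k .right e := by
      cases B.tag s k .right e <;> rfl
    rw [h3, h1, List.append_assoc, List.append_assoc, List.singleton_append, h2]
    simp [nextGaps, Function.comp_def]

theorem exists_isGaps (hB : B.IsSBush s) : ∀ k ≤ n, ∃ G, IsGaps s B k G := by
  refine level_induction ⟨[], isGaps_zero⟩ fun k ⟨G, hG⟩ => ?_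
  obtain ⟨A, C, h, h'⟩ := hB.front_split k
  exact ⟨_, hG.succ hB h h'⟩

/-- The label between the two leaves to which a node is attached. -/
theorem IsGaps.tag_eq {k : Fin n} {A C : List (Edge n)} {G : List (Tag n)}
    (hG : IsGaps s B k G) (h : B.front k = A ++ B.inc k ++ C) {f e : Edge n}
    (hk : B.inc k = [f, e]) : B.tag s k .left e = G[A.length]? ∧
      B.tag s k .right f = G[A.length]? := by
  have h1 := congrArg (fun l => l[A.length + 1]?) hG.1
  have h2 := congrArg (fun l => l[A.length]?) hG.2
  have hlen := hG.length
  rw [h, hk] at h1 h2 hlen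
  simp only [List.length_append, List.length_cons, List.length_nil] at hlen
  have hlt : A.length < G.length := by omega
  simp only [List.getElem?_map] at h1 h2 ⊢
  simp [hlt, List.getElem?_append] at h1 h2
  simp [hlt, h1, h2]

/-- The two merged leaves share the gap between them, which is not an outer one and therefore has a
label. -/
theorem exists_tag_of_two (hB : B.IsSBush s) {k : Fin n} {f e : Edge n}
    (hk : B.inc k = [f, e]) : ∃ g, B.tag s k .left e = some g ∧ B.tag s k .right f = some g := by
  obtain ⟨A, C, h, -⟩ := hB.front_split k
  obtain ⟨G, hG⟩ := exists_isGaps hB k k.2.le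
  have hlen := hG.length
  rw [h, hk] at hlen
  simp only [List.length_append, List.length_cons, List.length_nil] at hlen
  have hlt : A.length < G.length := by omega
  obtain ⟨h1, h2⟩ := hG.tag_eq h hk
  exact ⟨G[A.length], by simpa [hlt] using h1, by simpa [hlt] using h2⟩

end Bush
end SBush

/-! ### Backward extreme paths are the leftmost and rightmost paths -/

namespace SBush

/-- The order of positions, seen from the side `d`. -/
def Side.Lt : Side → ℕ → ℕ → Prop
  | .left, a, b => a < b
  | .right, a, b => b < a

namespace Bush

variable {n : ℕ} {s : Fin n → ℕ} {B : Bush n}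

/-- The path `p` branches off the path `q` towards the side `d`. -/
def Beats (d : Side) (p q : List (Edge n)) : Prop :=
  ∃ r a b u v, p.map Prod.snd = r ++ a :: u ∧ q.map Prod.snd = r ++ b :: v ∧ d.Lt a b

theorem Beats.append {d : Side} {p q : List (Edge n)} (h : Beats d p q) (x y : List (Edge n)) :
    Beats d (p ++ x) (q ++ y) := by
  obtain ⟨r, a, b, u, v, h1, h2, h3⟩ := h
  exact ⟨r, a, b, u ++ x.map Prod.snd, v ++ y.map Prod.snd, by simp [h1], by simp [h2], h3⟩

theorem append_cons_lt {r u v : List ℕ} {a b : ℕ} (h : a < b) : r ++ a :: u < r ++ b :: v := by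
  induction r with
  | nil => exact List.cons_lt_cons_iff.2 (.inl h)
  | cons c r ih => exact List.cons_lt_cons_iff.2 (.inr ⟨rfl, ih⟩)

theorem isExtreme_of_beats {d : Side} {P : List (Edge n) → Prop} {p : List (Edge n)} (hp : P p)
    (h : ∀ q, P q → p = q ∨ Beats d p q) : IsExtreme P d p := by
  cases d
  · refine ⟨hp, fun q hq => ?_⟩
    rcases h q hq with rfl | ⟨r, a, b, u, v, h1, h2, h3⟩
    · exact le_rfl
    · rw [h1, h2]
      exact (append_cons_lt h3).le
  · refine ⟨hp, fun q hq => ?_⟩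
    rcases h q hq with rfl | ⟨r, a, b, u, v, h1, h2, h3⟩
    · exact le_rfl
    · rw [h1, h2]
      exact (append_cons_lt h3).le

theorem IsExtreme.prop {d : Side} {P : List (Edge n) → Prop} {p : List (Edge n)}
    (hp : IsExtreme P d p) : P p := by
  cases d <;> exact hp.1

theorem IsExtreme.not_beats {d : Side} {P : List (Edge n) → Prop} {p q : List (Edge n)}
    (hp : IsExtreme P d p) (hq : P q) : ¬ Beats d q p := by
  rintro ⟨r, a, b, u, v, h1, h2, h3⟩
  cases d
  · have := hp.2 q hq
    rw [h1, h2] at this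
    exact absurd (append_cons_lt h3) this.not_gt
  · have := hp.2 q hq
    rw [h1, h2] at this
    exact absurd (append_cons_lt h3) this.not_gt

theorem IsExtreme.map_snd_eq {d : Side} {P : List (Edge n) → Prop} {p q : List (Edge n)}
    (hp : IsExtreme P d p) (hq : IsExtreme P d q) : p.map Prod.snd = q.map Prod.snd := by
  cases d
  · exact le_antisymm (hp.2 q hq.1) (hq.2 p hp.1)
  · exact le_antisymm (hq.2 p hp.1) (hp.2 q hq.1)

theorem befSide_succ (hB : B.IsSBush s) (k : Fin n) {d : Side} {e f : Edge n}
    (h : B.BefSide d (k + 1) e f) :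
    (e.1 = some k ∧ f.1 = some k ∧ d.Lt e.2 f.2) ∨
    (e.1 = some k ∧ f.1 ≠ some k ∧ f ∉ B.inc k ∧ ∀ a ∈ B.inc k, B.BefSide d k a f) ∨
    (f.1 = some k ∧ e.1 ≠ some k ∧ e ∉ B.inc k ∧ ∀ a ∈ B.inc k, B.BefSide d k e a) ∨
    (e.1 ≠ some k ∧ f.1 ≠ some k ∧ e ∉ B.inc k ∧ f ∉ B.inc k ∧ B.BefSide d k e f) := by
  cases d <;> rcases (hB.bef_succ k).1 h with h | h | h | h <;>
    simp only [BefSide, Side.Lt] <;> tauto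

theorem BefSide.mem {d : Side} {k : ℕ} {e f : Edge n} (h : B.BefSide d k e f) :
    e ∈ B.front k ∧ f ∈ B.front k := by
  cases d
  · exact pair_sublist_mem h
  · exact (pair_sublist_mem h).symm

theorem BefSide.ne (hB : B.IsSBush s) {d : Side} {k : ℕ} (hk : k ≤ n) {e f : Edge n}
    (h : B.BefSide d k e f) : e ≠ f := by
  cases d
  · exact pair_sublist_ne (hB.nodup_front hk) h
  · exact (pair_sublist_ne (hB.nodup_front hk) h).symm

/-- The extreme backward path is the extreme path. -/
theorem SideTrail.eq_or_beats (hB : B.IsSBush s) {d : Side} {i : Fin n} {t : ℕ} : ∀ k ≤ n,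
    ∀ e f p q, e ∈ B.front k → B.SideTrail d i t e p → B.Trail i f q →
      (e = f ∨ B.BefSide d k e f) → p = q ∨ Beats d p q := by
  refine level_induction ?_ ?_
  · intro e f p q he hp hq
    obtain ⟨a, u, rfl⟩ := (hp.trail hB).exists_fst
    simp [front] at he
  · intro k ih e f p q he hp hq hef
    have hpt := hp.trail hB
    obtain ⟨a, u, rfl⟩ := hpt.exists_fst
    obtain ⟨b, v, rfl⟩ := hq.exists_fst
    have hold : ∀ {a u p}, B.Trail i (some a, u) p → (some a, u) ∈ B.front (k + 1) → a ≠ k → i < k := by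
      intro a u p h hmem hne
      have h1 := h.le_fst hB a u rfl
      have h2 := hB.lt_of_mem_front k.2 hmem
      exact lt_of_le_of_lt h1 (lt_of_le_of_ne (Nat.lt_succ_iff.1 h2) hne)
    have hsnoc : a = k → i ≠ k → ∃ e' p', B.near d k = some e' ∧ B.SideTrail d i t e' p' ∧
        p = p' ++ [(some a, u)] := by
      rintro rfl hik
      rcases hp.cases_fst hB with ⟨h, -⟩ | ⟨-, -, e', p', h1, h2, h3⟩
      · exact absurd h hik
      · exact ⟨e', p', h1, h2, h3⟩
    -- Two trails that end with edges of the same node have separated before it, or else agree up to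
    -- it, and then the positions of the last edges decide.
    have hnew : ∀ v, b = k → a = k → ((some a, u) : Edge n) = (some b, v) ∨ d.Lt u v →
        B.Trail i (some b, v) q → p = q ∨ Beats d p q := by
      intro v hb ha huv hq
      subst hb
      subst ha
      by_cases hik : i = a
      · subst hik
        rw [hpt.eq_single hB, hq.eq_single hB]
        rcases huv with huv | huv
        · exact .inl (by rw [huv])
        · exact .inr ⟨[], u, v, [], [], rfl, rfl, huv⟩
      · obtain ⟨e', p', h1, h2, rfl⟩ := hsnoc rfl hik
        obtain ⟨f', q', h3, h4, rfl⟩ := hq.exists_snoc hik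
        rcases ih e' f' p' q' (hB.mem_front_of_mem_inc (hB.near_mem h1)) h2 h4
          (hB.near_befSide h1 h3) with rfl | h5
        · rcases huv with huv | huv
          · exact .inl (by rw [huv])
          · exact .inr ⟨p'.map Prod.snd, u, v, [], [], by simp, by simp, huv⟩
        · exact .inr (h5.append _ _)
    rcases hef with hef | hef
    · by_cases ha : a = k
      · cases hef
        exact hnew u ha ha (.inl rfl) hq
      · rcases (hB.mem_front_succ k).1 he with ⟨h1, h2⟩ | ⟨h1, h2, h3⟩
        · exact absurd (Option.some.inj h1) ha
        · exact ih _ _ p q h2 hp hq (.inl hef)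
    · rcases befSide_succ hB k hef with ⟨h1, h2, h3⟩ | ⟨h1, h2, h3, h4⟩ | ⟨h1, h2, h3, h4⟩ |
        ⟨h1, h2, h3, h4, h5⟩
      · exact hnew v (Option.some.inj h2) (Option.some.inj h1) (.inr h3) hq
      · have hik := hold hq hef.mem.2 fun h => h2 (by rw [h])
        obtain ⟨e', p', h5, h6, rfl⟩ := hsnoc (Option.some.inj h1) hik.ne
        have h7 := h4 e' (hB.near_mem h5)
        rcases ih _ _ _ _ h7.mem.1 h6 hq (.inr h7) with rfl | h8
        · have h9 := h6.trail hB
          have := (h9.getLast?_eq).symm.trans hq.getLast?_eq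
          exact absurd (Option.some.inj this) (h7.ne hB k.2.le)
        · have := h8.append [(some a, u)] []
          rw [List.append_nil] at this
          exact .inr this
      · have hik := hold hpt hef.mem.1 fun h => h2 (by rw [h])
        obtain rfl := Option.some.inj h1
        obtain ⟨f', q', h5, h6, rfl⟩ := hq.exists_snoc hik.ne
        have h7 := h4 f' h5
        rcases ih _ _ _ _ h7.mem.1 hp h6 (.inr h7) with rfl | h8
        · have := (hpt.getLast?_eq).symm.trans h6.getLast?_eq
          exact absurd (Option.some.inj this) (h7.ne hB b.2.le)
        · have := h8.append [] [(some b, v)]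
          rw [List.append_nil] at this
          exact .inr this
      · exact ih _ _ p q h5.mem.1 hp hq (.inr h5)

theorem IsPath.snoc {i a j : Fin n} {t : ℕ} {p : List (Edge n)} (h : B.IsPath i a p)
    (hj : (some a, t) ∈ B.inc j) : B.IsPath i j (p ++ [(some a, t)]) := by
  induction h with
  | nil i => exact .cons hj (.nil _)
  | cons hk _ ih => exact .cons hk (ih hj)

theorem Trail.cons {i k : Fin n} {t : ℕ} {e : Edge n} {p : List (Edge n)} (h : B.Trail k e p)
    (hk : (some i, t) ∈ B.inc k) : B.Trail i e ((some i, t) :: p) := by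
  induction h with
  | single u => exact (Trail.single t).snoc u hk
  | snoc u _ hm ih => exact ih.snoc u hm

theorem Trail.exists_isPath {i : Fin n} {e : Edge n} {p : List (Edge n)} (h : B.Trail i e p) :
    ∃ q a t, e = (some a, t) ∧ p = q ++ [e] ∧ B.IsPath i a q := by
  induction h with
  | single t => exact ⟨[], i, t, rfl, rfl, .nil i⟩
  | @snoc e p k t _ hk ih =>
    obtain ⟨q, a, u, rfl, rfl, hq⟩ := ih
    exact ⟨_, k, t, rfl, rfl, hq.snoc hk⟩

theorem Trail.isPath {i j : Fin n} {e : Edge n} {p : List (Edge n)} (h : B.Trail i e p)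
    (hj : e ∈ B.inc j) : B.IsPath i j p := by
  obtain ⟨q, a, t, rfl, rfl, hq⟩ := h.exists_isPath
  exact hq.snoc hj

theorem IsPath.trail {i j : Fin n} {p : List (Edge n)} (h : B.IsPath i j p) :
    (p = [] ∧ i = j) ∨ ∃ e ∈ B.inc j, B.Trail i e p := by
  induction h with
  | nil i => exact .inl ⟨rfl, rfl⟩
  | @cons i k j t p hk h ih =>
    rcases ih with ⟨rfl, rfl⟩ | ⟨e, he, h'⟩
    · exact .inr ⟨_, hk, .single t⟩
    · exact .inr ⟨e, he, h'.cons hk⟩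

theorem isAncestor_iff {i a : Fin n} {t : ℕ} :
    B.IsAncestor i a ↔ ∃ p, B.Trail i (some a, t) p := by
  constructor
  · rintro ⟨p, hp⟩
    rcases hp.trail with ⟨rfl, rfl⟩ | ⟨e, he, h⟩
    · exact ⟨_, .single t⟩
    · exact ⟨_, h.snoc t he⟩
  · rintro ⟨p, hp⟩
    obtain ⟨q, a', t', h1, -, h2⟩ := hp.exists_isPath
    cases h1
    exact ⟨q, h2⟩

/-- Each edge determines its end, so a path is recovered from its start and its positions. This
matters because `IsExtreme` compares positions only, while `mu` and `nu` obtain their path by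
choice. -/
theorem IsPath.eq_of_map_snd (hB : B.IsSBush s) {i j j' : Fin n} {p q : List (Edge n)}
    (hp : B.IsPath i j p) (hq : B.IsPath i j' q) (h : p.map Prod.snd = q.map Prod.snd) : p = q := by
  induction hp generalizing q with
  | nil i => simpa using h.symm
  | cons hk _ ih =>
    cases hq with
    | nil => simp at h
    | cons hk' hq =>
      simp only [List.map_cons, List.cons.injEq] at h
      obtain ⟨rfl, h⟩ := h
      obtain rfl := hB.inc_unique hk hk'
      rw [ih hq h]

theorem Trail.lt (hB : B.IsSBush s) {i j : Fin n} {e : Edge n} {p : List (Edge n)}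
    (h : B.Trail i e p) (hj : e ∈ B.inc j) : i < j := by
  obtain ⟨a, t, rfl⟩ := h.exists_fst
  exact (h.le_fst hB a t rfl).trans_lt (hB.lt_of_mem_inc hj)

theorem SideTrail.lt_out (hB : B.IsSBush s) {d : Side} {i : Fin n} {t : ℕ} {e : Edge n}
    {p : List (Edge n)} (h : B.SideTrail d i t e p) : ∀ k ≤ n, e ∈ B.front k → t < B.out i := by
  induction h with
  | single _ => exact fun k hk he => hB.lt_out_of_mem_front hk he
  | @snoc e p k h hk ih => exact fun _ _ _ => ih k k.2.le (hB.mem_front_of_mem_inc (hB.near_mem hk))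

theorem isExit_iff {d : Side} {i : Fin n} {t : ℕ} :
    B.IsExit d (some i, t) ↔ (some i, t) = B.exit d i := by
  constructor
  · rintro ⟨k, hk⟩
    have : some i = some k := (congrArg Prod.fst hk).trans (exit_fst _ _)
    cases this
    exact hk
  · exact fun h => ⟨i, h⟩

/-- The label next to an edge that arrives at `k` through the other side. -/
theorem exists_opposite (hB : B.IsSBush s) {d : Side} {i k : Fin n} {t : ℕ} {e : Edge n}
    {p : List (Edge n)} (h : B.SideTrail d i t e p) (he : e ∈ B.inc k)
    (hc : B.Crosses d e k) : ∃ f ∈ B.inc k, ∃ u q, B.Trail i f q ∧ q.head? = some (some i, u) ∧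
      d.Lt u t := by
  have hek := hB.mem_front_of_mem_inc he
  obtain ⟨g, hg, hgi, hgs, -⟩ := h.tag_eq hB k k.2.le e p hek
  have ht := h.lt_out hB k k.2.le hek
  have hne := h.exists_cons.1
  cases d
  · obtain ⟨f, hf⟩ := hc
    have hf' : f ∈ B.inc k := by simp [hf]
    have hfk := hB.mem_front_of_mem_inc hf'
    obtain ⟨g', h1, h2⟩ := exists_tag_of_two hB hf
    rw [hg] at h1
    cases h1
    obtain ⟨u, q, hq⟩ := exists_sideTrail hB k k.2.le f hfk g h2
    obtain ⟨g', h3, h4, h5, -⟩ := hq.tag_eq hB k k.2.le f q hfk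
    rw [h2] at h3
    cases h3
    rw [hgi] at hq h5
    have hu := hq.lt_out hB k k.2.le hfk
    obtain ⟨hne', r, rfl, -⟩ := hq.exists_cons
    refine ⟨f, hf', u, _, hq.trail hB, rfl, ?_⟩
    -- The same label is the left gap of position `t` and the right gap of position `u`. Equality of
    -- its initial entries forces `u = t - 1`; both positions lie in the range where the
    -- subtractions are not truncated.
    simp only [Side.start, Side.Lt, exit, ne_eq, Prod.mk.injEq, true_and] at *
    omega
  · obtain ⟨f, hf⟩ := hc
    have hf' : f ∈ B.inc k := by simp [hf]
    have hfk := hB.mem_front_of_mem_inc hf'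
    obtain ⟨g', h1, h2⟩ := exists_tag_of_two hB hf
    rw [hg] at h2
    cases h2
    obtain ⟨u, q, hq⟩ := exists_sideTrail hB k k.2.le f hfk g h1
    obtain ⟨g', h3, h4, h5, -⟩ := hq.tag_eq hB k k.2.le f q hfk
    rw [h1] at h3
    cases h3
    rw [hgi] at hq h5
    have hu := hq.lt_out hB k k.2.le hfk
    obtain ⟨hne', r, rfl, -⟩ := hq.exists_cons
    refine ⟨f, hf', u, _, hq.trail hB, rfl, ?_⟩
    simp only [Side.start, Side.Lt, exit, ne_eq, Prod.mk.injEq, true_and] at *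
    omega

/-- The trail is a `SideTrail` as long as it enters each node through the incoming edge on the side
`d`. At the first node entered through the other edge, both incoming edges touch one label;
`exists_opposite` then gives a path that already separates at `i` towards `d`, and extending both
paths preserves this. -/
theorem Trail.sideTrail_or_beaten (hB : B.IsSBush s) {d : Side} {i : Fin n} {e : Edge n}
    {p : List (Edge n)} (h : B.Trail i e p) : ∀ e₁ p₁, p = e₁ :: p₁ → ¬ B.IsExit d e₁ →
      (∀ f ∈ p₁, B.IsExit d f) → (∃ t, B.SideTrail d i t e p) ∨ ∃ q, B.Trail i e q ∧ Beats d q p := by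
  induction h with
  | single t =>
    intro e₁ p₁ hp he₁ _
    cases hp
    exact .inl ⟨t, .single fun h => he₁ (isExit_iff.2 h)⟩
  | @snoc e p k t h hk ih =>
    intro e₁ p₁ hp he₁ hp₁
    obtain ⟨p₂, rfl⟩ : ∃ p₂, p = e₁ :: p₂ := by
      cases p with
      | nil => exact absurd h.mem (by simp)
      | cons a p₂ => simp at hp; exact ⟨p₂, by rw [hp.1]⟩
    obtain rfl : p₂ ++ [(some k, t)] = p₁ := by simpa using hp
    have hx : (some k, t) = B.exit d k := isExit_iff.1 (hp₁ _ (by simp))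
    rcases ih e₁ p₂ rfl he₁ fun f hf => hp₁ f (by simp [hf]) with ⟨u, hu⟩ | ⟨q, hq, hb⟩
    · by_cases hc : B.Crosses d e k
      · obtain ⟨f, hf, v, q, hq, hqv, hlt⟩ := exists_opposite hB hu hk hc
        obtain ⟨-, r, hr, -⟩ := hu.exists_cons
        obtain ⟨r', rfl⟩ := List.head?_eq_some_iff.1 hqv
        refine .inr ⟨_, hq.snoc t hf, ?_⟩
        rw [hr]
        exact ⟨[], v, u, _, _, rfl, rfl, hlt⟩
      · rw [hx]
        exact .inl ⟨u, hu.snoc (hB.near_iff.2 ⟨hk, hc⟩)⟩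
    · exact .inr ⟨_, hq.snoc t hk, hb.append _ _⟩

/-! ### Ascents, descents and holes read off the labels -/

/-- The paths that turn only at their start correspond to the labels. -/
theorem turnsOnlyAt_iff (hB : B.IsSBush s) {d : Side} {i j : Fin n} {e : Edge n}
    (hj : B.inc j = [e]) : B.TurnsOnlyAt d i j ↔ ∃ g, B.tag s j d e = some g ∧ g.node = i := by
  have hej : e ∈ B.inc j := by simp [hj]
  have hek := hB.mem_front_of_mem_inc hej
  constructor
  · rintro ⟨e₁, p, hp, he₁, hpx⟩
    rcases (IsExtreme.prop hp).trail with ⟨h, -⟩ | ⟨e', he', h⟩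
    · simp at h
    · obtain rfl : e' = e := by simpa [hj] using he'
      have hp' : IsExtreme (B.IsPath i j) d (e₁ :: p) := hp
      rcases h.sideTrail_or_beaten hB e₁ p rfl he₁ hpx with ⟨t, ht⟩ | ⟨q, hq, hb⟩
      · obtain ⟨g, hg, hgi, -⟩ := ht.tag_eq hB j j.2.le _ _ hek
        exact ⟨g, hg, hgi⟩
      · exact absurd hb (hp'.not_beats (hq.isPath hej))
  · rintro ⟨g, hg, rfl⟩
    obtain ⟨t, p, hp⟩ := exists_sideTrail hB j j.2.le e hek g hg
    have hpt := hp.trail hB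
    obtain ⟨hne, q, rfl, hq⟩ := hp.exists_cons
    refine ⟨_, q, isExtreme_of_beats (hpt.isPath hej) fun r hr => ?_,
      fun h => hne (isExit_iff.1 h), hq⟩
    rcases hr.trail with ⟨-, h⟩ | ⟨e', he', h⟩
    · exact absurd h (hpt.lt hB hej).ne
    · obtain rfl : e' = e := by simpa [hj] using he'
      exact hp.eq_or_beats hB j j.2.le _ _ _ _ hek h (.inl rfl)

/-- A leaf has at most one label on each side, so at most one node qualifies and maximality is
automatic. -/
theorem isGreatest_turnsOnlyAt_iff (hB : B.IsSBush s) {d : Side} {i j : Fin n} {e : Edge n}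
    (hj : B.inc j = [e]) : IsGreatest {k | B.TurnsOnlyAt d k j} i ↔
      ∃ g, B.tag s j d e = some g ∧ g.node = i := by
  constructor
  · exact fun h => (turnsOnlyAt_iff hB hj).1 h.1
  · intro h
    refine ⟨(turnsOnlyAt_iff hB hj).2 h, fun k hk => ?_⟩
    obtain ⟨g, hg, rfl⟩ := h
    obtain ⟨g', hg', rfl⟩ := (turnsOnlyAt_iff hB hj).1 hk
    rw [hg] at hg'
    cases hg'
    exact le_rfl

/-- The label between two descendants of `k` is not created before `k`. -/
theorem le_node_of_between (hB : B.IsSBush s) {k : Fin n} : ∀ m ≤ n, ∀ f e e' p q,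
    B.Trail k f p → B.Trail k e' q → B.Bef m f e → (e = e' ∨ B.Bef m e e') →
      ∃ g, B.tag s m .left e = some g ∧ k ≤ g.node := by
  refine level_induction ?_ ?_
  · intro f e e' p q hf he' hfe
    obtain ⟨a, t, rfl⟩ := hf.exists_fst
    have := (pair_sublist_mem hfe).1
    simp [front] at this
  · intro m ih f e e' p q hf he' hfe hee'
    have hfm := (pair_sublist_mem hfe).1
    have hem := (pair_sublist_mem hfe).2
    have he'm : e' ∈ B.front (m + 1) := by
      rcases hee' with rfl | h
      · exact hem
      · exact (pair_sublist_mem h).2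
    have hkm : k ≤ m := by
      obtain ⟨a, t, rfl⟩ := hf.exists_fst
      have := hf.le_fst hB a t rfl
      have h2 := hB.lt_of_mem_front m.2 hfm
      exact this.trans (Nat.lt_succ_iff.1 h2)
    have hpar : ∀ {e p}, B.Trail k e p → e.1 = some m → k ≠ m → ∃ e₀ ∈ B.inc m, ∃ p, B.Trail k e₀ p := by
      intro e p h h1 h2
      obtain ⟨a, t, rfl⟩ := h.exists_fst
      cases h1
      obtain ⟨e₀, q, h3, h4, -⟩ := h.exists_snoc h2
      exact ⟨e₀, h3, q, h4⟩
    have hold : ∀ {e p}, e ∈ B.front (m + 1) → B.Trail k e p → e.1 ≠ some m → k ≠ m := by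
      rintro e p h1 h2 h3 rfl
      obtain ⟨a, t, rfl⟩ := h2.exists_fst
      have h4 := hB.lt_of_mem_front k.2 h1
      have h5 := h2.le_fst hB a t rfl
      exact h3 (congrArg some (le_antisymm (Nat.lt_succ_iff.1 h4) h5))
    by_cases hnew : e.1 = some m
    · obtain ⟨a, t⟩ := e
      cases hnew
      by_cases hx : (some m, t) = B.exit .left m
      · obtain ⟨e₀, he₀⟩ := hB.exists_near .left m
        have ht : t = 0 := by simpa [exit] using hx
        subst ht
        rcases (hB.bef_succ m).1 hfe with ⟨-, -, h, -⟩ | ⟨-, -, h, -⟩ | ⟨-, -, h1, h2, h3⟩ | ⟨-, h, -⟩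
        · exact absurd h (Nat.not_lt_zero _)
        · exact absurd rfl h
        · have hne := hold hfm hf h1
          have hfe₀ := h3 e₀ (hB.near_mem he₀)
          -- The edge `e₀` need not descend from `k` when only the other incoming edge of `m` does.
          -- This is why the induction allows an endpoint `e'` further to the right.
          obtain ⟨e₁, q₁, he₁, hle⟩ : ∃ e₁ q₁, B.Trail k e₁ q₁ ∧ (e₀ = e₁ ∨ B.Bef m e₀ e₁) := by
            by_cases h4 : e'.1 = some m
            · obtain ⟨e₁, h5, q₁, h6⟩ := hpar he' h4 hne
              exact ⟨e₁, q₁, h6, hB.near_befSide he₀ h5⟩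
            · rcases hee' with rfl | hee'
              · exact absurd rfl h4
              · refine ⟨e', q, he', .inr ?_⟩
                rcases (hB.bef_succ m).1 hee' with ⟨-, h, -⟩ | ⟨-, -, -, -, h⟩ | ⟨h, -⟩ | ⟨h, -⟩
                · exact absurd h h4
                · exact h _ (hB.near_mem he₀)
                · exact absurd h h4
                · exact absurd rfl h
          obtain ⟨g, hg, hkg⟩ := ih f e₀ e₁ p q₁ hf he₁ hfe₀ hle
          exact ⟨g.push (Side.left.gain (s m - 1)), by rw [hx, tag_exit m he₀, hg]; rfl, hkg⟩
        · exact absurd rfl h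
      · exact ⟨_, tag_new m hx, hkm⟩
    · have hne : k ≠ m := by
        rcases hee' with rfl | hee'
        · exact hold hem he' hnew
        · by_cases h1 : e'.1 = some m
          -- An old leaf such as `e` cannot lie between two leaves of `m`.
          · refine hold hfm hf fun h2 => ?_
            have h3 := (hB.bef_succ m).1 hfe
            have h4 := (hB.bef_succ m).1 hee'
            simp only [h1, h2, hnew, ne_eq, not_true_eq_false, not_false_eq_true, false_and, and_false,
              or_false, false_or, true_and] at h3 h4
            obtain ⟨a, ha⟩ := List.exists_mem_of_ne_nil _ (hB.inc_ne_nil m)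
            exact pair_sublist_asymm (hB.nodup_front m.2.le) (h3.2.2 a ha) (h4.2.2 a ha)
          · exact hold he'm he' h1
      obtain ⟨f₁, p₁, hf₁, hle₁⟩ : ∃ f₁ p₁, B.Trail k f₁ p₁ ∧ B.Bef m f₁ e := by
        rcases (hB.bef_succ m).1 hfe with ⟨-, h, -⟩ | ⟨h1, -, -, -, h⟩ | ⟨h, -⟩ | ⟨-, -, -, -, h⟩
        · exact absurd h hnew
        · obtain ⟨f₁, h2, p₁, h3⟩ := hpar hf h1 hne
          exact ⟨f₁, p₁, h3, h f₁ h2⟩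
        · exact absurd h hnew
        · exact ⟨f, p, hf, h⟩
      obtain ⟨e₁, q₁, he₁, hle⟩ : ∃ e₁ q₁, B.Trail k e₁ q₁ ∧ (e = e₁ ∨ B.Bef m e e₁) := by
        rcases hee' with rfl | hee'
        · exact ⟨e, q, he', .inl rfl⟩
        · rcases (hB.bef_succ m).1 hee' with ⟨h, -⟩ | ⟨h, -⟩ | ⟨h1, -, -, -, h⟩ | ⟨-, -, -, -, h⟩
          · exact absurd h hnew
          · exact absurd h hnew
          · obtain ⟨e₁, h2, q₁, h3⟩ := hpar he' h1 hne
            exact ⟨e₁, q₁, h3, .inr (h e₁ h2)⟩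
          · exact ⟨e', q, he', .inr h⟩
      obtain ⟨g, hg, hkg⟩ := ih f₁ e e₁ p₁ q₁ hf₁ he₁ hle₁ hle
      classical
      exact ⟨g.push (if B.Ahead m e then s m - 1 else 0), by rw [tag_old m hnew, hg]; rfl, hkg⟩

/-- The holes correspond to the labels between two leaves that are merged. -/
theorem isHole_iff (hB : B.IsSBush s) {i j : Fin n} : B.IsHole i j ↔
    ∃ f e g, B.inc j = [f, e] ∧ B.tag s j .left e = some g ∧ g.node = i := by
  have key : ∀ {f e}, B.inc j = [f, e] → ∃ a b t u g, f = (some a, t) ∧ e = (some b, u) ∧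
      B.tag s j .left e = some g ∧ IsGreatest {k | B.IsAncestor k a ∧ B.IsAncestor k b} g.node := by
    intro f e hj
    have hf : f ∈ B.inc j := by simp [hj]
    have he : e ∈ B.inc j := by simp [hj]
    obtain ⟨g, hg, hg'⟩ := exists_tag_of_two hB hj
    obtain ⟨_, p, hp⟩ := exists_sideTrail hB j j.2.le e (hB.mem_front_of_mem_inc he) g hg
    obtain ⟨_, q, hq⟩ := exists_sideTrail hB j j.2.le f (hB.mem_front_of_mem_inc hf) g hg'
    have hp := hp.trail hB
    have hq := hq.trail hB
    obtain ⟨b, u, rfl⟩ := hp.exists_fst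
    obtain ⟨a, t, rfl⟩ := hq.exists_fst
    refine ⟨a, b, t, u, g, rfl, rfl, hg, ⟨isAncestor_iff.2 ⟨q, hq⟩, isAncestor_iff.2 ⟨p, hp⟩⟩, ?_⟩
    rintro k ⟨hka, hkb⟩
    obtain ⟨q', hq'⟩ := isAncestor_iff (t := t).1 hka
    obtain ⟨p', hp'⟩ := isAncestor_iff (t := u).1 hkb
    have hs := (hB j).1.sublist
    rw [hj] at hs
    obtain ⟨g', hg', hle⟩ := le_node_of_between hB j j.2.le _ _ _ _ _ hq' hp' hs (.inl rfl)
    rw [hg] at hg'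
    cases hg'
    exact hle
  constructor
  · rintro ⟨a, b, t, u, hj, hi⟩
    obtain ⟨a', b', t', u', g, h1, h2, hg, hgr⟩ := key hj
    cases h1
    cases h2
    exact ⟨_, _, g, hj, hg, hgr.unique hi⟩
  · rintro ⟨f, e, g, hj, hg, rfl⟩
    obtain ⟨a, b, t, u, g', rfl, rfl, hg', hgr⟩ := key hj
    rw [hg] at hg'
    cases hg'
    exact ⟨a, b, t, u, hj, hgr⟩

/-! ### Right-hand sides as second entries of labels -/

theorem isAdmissible_iff_of_one {d : Side} {i j : Fin n} {e : Edge n}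
    (hj : B.inc j = [e]) (hij : i ≠ j) {q : List (Edge n)} :
    B.IsAdmissible d i j q ↔ B.Trail i e q := by
  have hh : ¬ B.IsHole i j := by
    rintro ⟨a, b, t, u, h, -⟩
    simp [hj] at h
  simp only [IsAdmissible, hh, false_implies, and_true]
  constructor
  · intro h
    rcases h.trail with ⟨-, h⟩ | ⟨e', he', h⟩
    · exact absurd h hij
    · obtain rfl : e' = e := by simpa [hj] using he'
      exact h
  · exact fun h => h.isPath (by simp [hj])

/-- For a hole, the arrival condition selects the right incoming edge, whose left label is the one
between the merged leaves. -/
theorem isAdmissible_iff_of_two {i j : Fin n} {f e : Edge n}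
    (hj : B.inc j = [f, e]) (hij : B.IsHole i j) {q : List (Edge n)} :
    B.IsAdmissible .left i j q ↔ B.Trail i e q := by
  have hc : ∀ e', B.Crosses .left e' j ↔ e' = e := by simp [Crosses, hj, eq_comm]
  simp only [IsAdmissible, hij, true_implies, hc]
  constructor
  · rintro ⟨h, e', he', rfl⟩
    rcases h.trail with ⟨rfl, h⟩ | ⟨e'', he'', h⟩
    · simp at he'
    · have := h.getLast?_eq
      rw [he'] at this
      obtain rfl := Option.some.inj this
      exact h
  · exact fun h => ⟨h.isPath (by simp [hj]), e, h.getLast?_eq, rfl⟩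

/-- The backward path that carries the label is the leftmost admissible path, hence equal to the
chosen one. `SideTrail.tag_eq` then identifies the initial entry with `r - 1` and the shift with the
weight. -/
theorem mu_eq (hB : B.IsSBush s) {j : Fin n} {e : Edge n} {g : Tag n} (he : e ∈ B.inc j)
    (hg : B.tag s j .left e = some g)
    (h : ∀ q, B.IsAdmissible .left g.node j q ↔ B.Trail g.node e q) :
    B.mu s g.node j = (g.start + g.shift : ℕ) := by
  have hek := hB.mem_front_of_mem_inc he
  obtain ⟨t, p, hp⟩ := exists_sideTrail hB j j.2.le e hek g hg
  have ht := hp.lt_out hB j j.2.le hek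
  obtain ⟨g', h1, -, h3, h4⟩ := hp.tag_eq hB j j.2.le e p hek
  rw [hg] at h1
  cases h1
  have hpt := hp.trail hB
  obtain ⟨-, q, rfl, -⟩ := hp.exists_cons
  have hex : IsExtreme (B.IsAdmissible .left g.node j) .left ((some g.node, t) :: q) :=
    isExtreme_of_beats ((h _).2 hpt) fun r hr =>
      hp.eq_or_beats hB j j.2.le _ _ _ _ hek ((h r).1 hr) (.inl rfl)
  have hE : ∃ π : Edge n × List (Edge n),
    IsExtreme (B.IsAdmissible .left g.node j) .left (π.1 :: π.2) := ⟨(_, q), hex⟩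
  have hc := hE.choose_spec
  have heq := IsPath.eq_of_map_snd hB hc.prop.1 hex.prop.1 (hc.map_snd_eq hex)
  unfold mu
  rw [dif_pos hE]
  generalize hE.choose = c at heq
  obtain ⟨c₁, c₂⟩ := c
  simp only [List.cons.injEq] at heq
  obtain ⟨rfl, rfl⟩ := heq
  rw [levelWeight_coe] at h4
  push_cast
  rw [h4, h3]
  simp only [Side.start]
  congr 1
  omega

theorem nu_eq (hB : B.IsSBush s) {j : Fin n} {e : Edge n} {g : Tag n} (he : e ∈ B.inc j)
    (hg : B.tag s j .right e = some g)
    (h : ∀ q, B.IsAdmissible .right g.node j q ↔ B.Trail g.node e q) :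
    B.nu s g.node j = (g.start + g.shift : ℕ) := by
  have hek := hB.mem_front_of_mem_inc he
  obtain ⟨t, p, hp⟩ := exists_sideTrail hB j j.2.le e hek g hg
  have ht := hp.lt_out hB j j.2.le hek
  obtain ⟨g', h1, -, h3, h4⟩ := hp.tag_eq hB j j.2.le e p hek
  rw [hg] at h1
  cases h1
  have hpt := hp.trail hB
  obtain ⟨hne, q, rfl, -⟩ := hp.exists_cons
  have hex : IsExtreme (B.IsAdmissible .right g.node j) .right ((some g.node, t) :: q) :=
    isExtreme_of_beats ((h _).2 hpt) fun r hr =>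
      hp.eq_or_beats hB j j.2.le _ _ _ _ hek ((h r).1 hr) (.inl rfl)
  have hE : ∃ π : Edge n × List (Edge n),
    IsExtreme (B.IsAdmissible .right g.node j) .right (π.1 :: π.2) := ⟨(_, q), hex⟩
  have hc := hE.choose_spec
  have heq := IsPath.eq_of_map_snd hB hc.prop.1 hex.prop.1 (hc.map_snd_eq hex)
  unfold nu
  rw [dif_pos hE]
  generalize hE.choose = c at heq
  obtain ⟨c₁, c₂⟩ := c
  simp only [List.cons.injEq] at heq
  obtain ⟨rfl, rfl⟩ := heq
  rw [levelWeight_coe] at h4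
  push_cast
  rw [h4, h3]
  -- The first edge is not the rightmost one, so the natural subtraction `B.out i - 2 - t` in
  -- `Side.start` is not truncated.
  simp only [exit, ne_eq, Prod.mk.injEq, true_and] at hne
  simp only [Side.start]
  congr 1
  omega

theorem node_lt (hB : B.IsSBush s) {d : Side} {k : ℕ} (hk : k ≤ n) {e : Edge n} (he : e ∈ B.front k)
    {g : Tag n} (hg : B.tag s k d e = some g) : (g.node : ℕ) < k := by
  obtain ⟨t, p, hp⟩ := exists_sideTrail hB k hk e he g hg
  have hpt := hp.trail hB
  obtain ⟨a, u, rfl⟩ := hpt.exists_fst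
  exact lt_of_le_of_lt (hpt.le_fst hB a u rfl) (hB.lt_of_mem_front hk he)

/-- The value of the label `g` is on the side `d` of `v`, or equal to `v`. -/
def SideLe (x : Fin n → ℝ) : Side → Tag n → ℝ → Prop
  | .left, g, v => g.val x ≤ v
  | .right, g, v => v ≤ g.val x

theorem hole_holds_iff (hB : B.IsSBush s) {j : Fin n} {f e : Edge n} {g : Tag n}
    (hj : B.inc j = [f, e]) (hg : B.tag s j .left e = some g) (x : Fin n → ℝ) :
    (Constraint.hole g.node j).Holds s B x ↔ x j = g.val x := by
  have hh : B.IsHole g.node j := (isHole_iff hB).2 ⟨f, e, g, hj, hg, rfl⟩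
  have := mu_eq hB (by simp [hj]) hg fun q => isAdmissible_iff_of_two hj hh
  simp only [Constraint.Holds, this, Tag.val]
  push_cast
  constructor <;> intro h <;> linarith

theorem ascent_holds_iff (hB : B.IsSBush s) {j : Fin n} {e : Edge n} {g : Tag n}
    (hj : B.inc j = [e]) (hg : B.tag s j .left e = some g) (x : Fin n → ℝ) :
    (Constraint.ascent g.node j).Holds s B x ↔ g.val x ≤ x j := by
  have he : e ∈ B.inc j := by simp [hj]
  have hlt := node_lt hB j.2.le (hB.mem_front_of_mem_inc he) hg
  have := mu_eq hB he hg fun q => isAdmissible_iff_of_one hj (Fin.ne_of_lt hlt)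
  simp only [Constraint.Holds, this, Tag.val]
  push_cast
  constructor <;> intro h <;> linarith

theorem descent_holds_iff (hB : B.IsSBush s) {j : Fin n} {e : Edge n} {g : Tag n}
    (hj : B.inc j = [e]) (hg : B.tag s j .right e = some g) (x : Fin n → ℝ) :
    (Constraint.descent g.node j).Holds s B x ↔ x j ≤ g.val x := by
  have he : e ∈ B.inc j := by simp [hj]
  have hlt := node_lt hB j.2.le (hB.mem_front_of_mem_inc he) hg
  have := nu_eq hB he hg fun q => isAdmissible_iff_of_one hj (Fin.ne_of_lt hlt)
  simp only [Constraint.Holds, this, Tag.val]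
  push_cast
  constructor <;> intro h <;> linarith

/-- The condition that makes a label of a node of indegree one a facet. -/
def Kept (s : Fin n → ℕ) (B : Bush n) (d : Side) (j : Fin n) : Prop :=
  s j = 0 ∨ ∀ d' k, B.Zigzag d j d' k → k ≠ j → (B.inc k).length = 2

theorem isSlope_iff (hB : B.IsSBush s) {d : Side} {i j : Fin n} : IsSlope s B d i j ↔
    ∃ e g, B.inc j = [e] ∧ B.tag s j d e = some g ∧ g.node = i ∧ Kept s B d j := by
  constructor
  · rintro ⟨h1, h2, h3⟩
    obtain ⟨e, hj⟩ := List.length_eq_one_iff.1 h1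
    obtain ⟨g, hg, hgi⟩ := (isGreatest_turnsOnlyAt_iff hB hj).1 h2
    exact ⟨e, g, hj, hg, hgi, h3⟩
  · rintro ⟨e, g, hj, hg, hgi, h3⟩
    exact ⟨by simp [hj], (isGreatest_turnsOnlyAt_iff hB hj).2 ⟨g, hg, hgi⟩, h3⟩

/-- Replaces the combinatorial names of the constraints by labels, the form in which the description
and its irredundancy are checked. -/
theorem system_iff (hB : B.IsSBush s) {P : Constraint n → Prop} :
    (∀ c ∈ system s B, P c) ↔
      (∀ j f e g, B.inc j = [f, e] → B.tag s j .left e = some g → P (.hole g.node j)) ∧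
      (∀ j e g, B.inc j = [e] → B.tag s j .left e = some g → Kept s B .left j →
        P (.ascent g.node j)) ∧
      (∀ j e g, B.inc j = [e] → B.tag s j .right e = some g → Kept s B .right j →
        P (.descent g.node j)) := by
  constructor
  · intro h
    exact ⟨fun j f e g hj hg => h (.hole g.node j) ((isHole_iff hB).2 ⟨f, e, g, hj, hg, rfl⟩),
      fun j e g hj hg hk => h (.ascent g.node j) ((isSlope_iff hB).2 ⟨e, g, hj, hg, rfl, hk⟩),
      fun j e g hj hg hk => h (.descent g.node j) ((isSlope_iff hB).2 ⟨e, g, hj, hg, rfl, hk⟩)⟩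
  · rintro ⟨h1, h2, h3⟩ (⟨i, j⟩ | ⟨i, j⟩ | ⟨i, j⟩) hc
    · obtain ⟨f, e, g, hj, hg, rfl⟩ := (isHole_iff hB).1 hc
      exact h1 j f e g hj hg
    · obtain ⟨e, g, hj, hg, rfl, hk⟩ := (isSlope_iff hB).1 hc
      exact h2 j e g hj hg hk
    · obtain ⟨e, g, hj, hg, rfl, hk⟩ := (isSlope_iff hB).1 hc
      exact h3 j e g hj hg hk

/-! ### Local conditions at a node and the order of labels around leaves -/

/-- The conditions on `x j` under which the node `j` is inserted as in `B`. -/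
def Fits (s : Fin n → ℕ) (B : Bush n) (j : Fin n) (x : Fin n → ℝ) : Prop :=
  (∀ e, B.inc j = [e] → (∀ g ∈ B.tag s j .left e, g.val x < x j) ∧
    ∀ g ∈ B.tag s j .right e, x j < g.val x) ∧
  ∀ f e, B.inc j = [f, e] → ∀ g ∈ B.tag s j .left e, x j = g.val x

/-- The weak form of `Fits`. -/
def FitsWeakly (s : Fin n → ℕ) (B : Bush n) (j : Fin n) (x : Fin n → ℝ) : Prop :=
  (∀ e, B.inc j = [e] → (∀ g ∈ B.tag s j .left e, g.val x ≤ x j) ∧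
    ∀ g ∈ B.tag s j .right e, x j ≤ g.val x) ∧
  ∀ f e, B.inc j = [f, e] → ∀ g ∈ B.tag s j .left e, x j = g.val x

theorem Fits.fitsWeakly {j : Fin n} {x : Fin n → ℝ} (h : Fits s B j x) : FitsWeakly s B j x :=
  ⟨fun e he => ⟨fun g hg => ((h.1 e he).1 g hg).le, fun g hg => ((h.1 e he).2 g hg).le⟩, h.2⟩

/-- The labels around the leaf `e` are in increasing order. -/
def LeafOk (s : Fin n → ℕ) (B : Bush n) (k : ℕ) (x : Fin n → ℝ) (e : Edge n) : Prop :=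
  ∀ g ∈ B.tag s k .left e, ∀ g' ∈ B.tag s k .right e, g.val x < g'.val x

/-- The weak form of `LeafOk`. -/
def LeafWeaklyOk (s : Fin n → ℕ) (B : Bush n) (k : ℕ) (x : Fin n → ℝ) (e : Edge n) : Prop :=
  ∀ g ∈ B.tag s k .left e, ∀ g' ∈ B.tag s k .right e, g.val x ≤ g'.val x

theorem val_push (x : Fin n → ℝ) (c : ℕ) (g : Tag n) : (g.push c).val x = g.val x - c := by
  simp only [Tag.val, Tag.push]
  push_cast
  ring

theorem exit_left_ne (k : Fin n) (h : B.out k ≠ 1) (h' : 1 ≤ B.out k) :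
    B.exit .left k ≠ B.exit .right k := by
  intro he
  have h2 : 0 = B.out k - 1 := congrArg Prod.snd he
  exact h (by omega)

/-- The entry of the leftmost gap of `k` equals the amount that `k` adds on its left; if `s k = 0`
and `k` has two outgoing edges, both vanish. -/
theorem out_sub_two (hB : B.IsSBush s) {k : Fin n} (h : B.out k ≠ 1) : B.out k - 2 = s k - 1 := by
  rw [(hB k).2.2] at h ⊢
  unfold numOut at *
  split_ifs at * <;> omega

/-- Both labels of an old leaf are pushed by the same amount. -/
theorem leafOk_old {k : Fin n} {x : Fin n → ℝ} {e : Edge n} (he : e.1 ≠ some k) :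
    (LeafOk s B (k + 1) x e ↔ LeafOk s B k x e) ∧
      (LeafWeaklyOk s B (k + 1) x e ↔ LeafWeaklyOk s B k x e) := by
  simp only [LeafOk, LeafWeaklyOk, tag_old k he, Option.mem_map, forall_exists_index, and_imp,
    forall_apply_eq_imp_iff₂, val_push, sub_lt_sub_iff_right, sub_le_sub_iff_right, and_self]

/-- The inherited left label has just been lowered by `s k - 1` and the right one is the new label
`(k, s k - 1)`. The two shifts cancel, leaving a comparison with `x k`. -/
theorem leafOk_exit_left (hB : B.IsSBush s) {k : Fin n} {x : Fin n → ℝ} {e : Edge n}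
    (hk : B.out k ≠ 1) (he : B.near .left k = some e) :
    (LeafOk s B (k + 1) x (B.exit .left k) ↔ ∀ g ∈ B.tag s k .left e, g.val x < x k) ∧
      (LeafWeaklyOk s B (k + 1) x (B.exit .left k) ↔ ∀ g ∈ B.tag s k .left e, g.val x ≤ x k) := by
  have h : B.tag s (k + 1) .right (B.exit .left k) = some ⟨k, s k - 1, 0⟩ := by
    have := tag_new (s := s) k (exit_left_ne k hk (hB.one_le_out k))
    rw [← out_sub_two hB hk]
    exact this
  simp only [LeafOk, LeafWeaklyOk, tag_exit k he, h, Option.mem_map, forall_exists_index, and_imp,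
    forall_apply_eq_imp_iff₂, val_push, Option.mem_some_iff, forall_eq']
  simp [Tag.val, Side.gain]

/-- Nothing is added on the right of `k`, and its last gap has value `x k`. -/
theorem leafOk_exit_right (hB : B.IsSBush s) {k : Fin n} {x : Fin n → ℝ} {e : Edge n}
    (hk : B.out k ≠ 1) (he : B.near .right k = some e) :
    (LeafOk s B (k + 1) x (B.exit .right k) ↔ ∀ g ∈ B.tag s k .right e, x k < g.val x) ∧
      (LeafWeaklyOk s B (k + 1) x (B.exit .right k) ↔ ∀ g ∈ B.tag s k .right e, x k ≤ g.val x) := by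
  have h : B.tag s (k + 1) .left (B.exit .right k) = some ⟨k, 0, 0⟩ := by
    have := tag_new (s := s) k (exit_left_ne k hk (hB.one_le_out k)).symm
    simpa [exit, Side.start] using this
  simp only [LeafOk, LeafWeaklyOk, tag_exit k he, h, Option.mem_map, forall_exists_index, and_imp,
    forall_apply_eq_imp_iff₂, val_push, Option.mem_some_iff, forall_eq']
  simp [Tag.val, Side.gain]

theorem leafOk_new {k : Fin n} {x : Fin n → ℝ} {t : ℕ}
    (hl : (some k, t) ≠ B.exit .left k) (hr : (some k, t) ≠ B.exit .right k) (ht : t < B.out k) :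
    LeafOk s B (k + 1) x (some k, t) := by
  simp only [exit, ne_eq, Prod.mk.injEq, true_and] at hl hr
  intro g hg g' hg'
  rw [tag_new k (by simpa [exit] using hl)] at hg
  rw [tag_new k (by simpa [exit] using hr)] at hg'
  cases hg
  cases hg'
  simp only [Tag.val, Side.start]
  have : B.out k - 2 - t + 0 < B.out k - 1 - t + 0 := by omega
  have : ((B.out k - 2 - t + 0 : ℕ) : ℝ) < (B.out k - 1 - t + 0 : ℕ) := by exact_mod_cast this
  linarith

theorem out_eq_one (hB : B.IsSBush s) {k : Fin n} (h : B.out k = 1) :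
    s k = 0 ∧ ∃ e, B.inc k = [e] := by
  have h1 := (hB k).2.2
  rw [h] at h1
  unfold numOut at h1
  split_ifs at h1 with h2
  · omega
  · refine ⟨by omega, ?_⟩
    rcases hB.inc_cases k with h3 | ⟨f, e, h3⟩
    · exact h3
    · exact absurd ⟨by omega, by simp [h3]⟩ h2

/-- When the node `k` has a single outgoing edge, the leaf is kept. -/
theorem leafOk_single (hB : B.IsSBush s) {k : Fin n} {x : Fin n → ℝ} {e : Edge n} (hk : B.out k = 1)
    (he : B.inc k = [e]) (h : LeafOk s B k x e) : LeafOk s B (k + 1) x (some k, 0) := by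
  have hs := (out_eq_one hB hk).1
  have hl : B.exit .left k = (some k, 0) := rfl
  have hr : B.exit .right k = (some k, 0) := by simp [exit, hk]
  intro g hg g' hg'
  rw [← hl, tag_exit k (f := e) (by simp [near, he]), Option.mem_map] at hg
  rw [← hr, tag_exit k (f := e) (by simp [near, he]), Option.mem_map] at hg'
  obtain ⟨g, hg, rfl⟩ := hg
  obtain ⟨g', hg', rfl⟩ := hg'
  simpa [val_push, Side.gain, hs] using h g hg g' hg'

/-- The pair that represents a label in the insertion algorithm. -/
def _root_.SBush.Tag.pair (g : Tag n) : Fin n × ℕ := (g.node, g.start + g.shift)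

/-- All leaves outside `E` have their labels in increasing order. -/
def Ordered (s : Fin n → ℕ) (B : Bush n) (E : Set (Edge n)) (k : ℕ) (x : Fin n → ℝ) : Prop :=
  ∀ e ∈ B.front k, e ∉ E → LeafOk s B k x e

/-- Insertion of a node whose extreme leaves are in order or belong to `E`. -/
theorem Ordered.succ (hB : B.IsSBush s) {E : Set (Edge n)} {k : Fin n} {x : Fin n → ℝ}
    (h : Ordered s B E k x)
    (h1 : ∀ e, B.out k = 1 → B.inc k = [e] → LeafOk s B k x e)
    (hl : B.out k ≠ 1 → B.exit .left k ∈ E ∨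
      ∀ e, B.near .left k = some e → ∀ g ∈ B.tag s k .left e, g.val x < x k)
    (hr : B.out k ≠ 1 → B.exit .right k ∈ E ∨
      ∀ e, B.near .right k = some e → ∀ g ∈ B.tag s k .right e, x k < g.val x) :
    Ordered s B E (k + 1) x := by
  intro e he heE
  rcases (hB.mem_front_succ k).1 he with ⟨h2, h3⟩ | ⟨h2, h3, h4⟩
  · obtain ⟨a, t⟩ := e
    simp only at h2 h3
    subst h2
    by_cases hk : B.out k = 1
    · obtain ⟨-, e, hke⟩ := out_eq_one hB hk
      obtain rfl : t = 0 := by omega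
      exact leafOk_single hB hk hke (h1 e hk hke)
    · by_cases htl : (some k, t) = B.exit .left k
      · obtain ⟨e, he⟩ := hB.exists_near .left k
        rw [htl, (leafOk_exit_left hB hk he).1]
        exact ((hl hk).resolve_left (htl ▸ heE)) e he
      · by_cases htr : (some k, t) = B.exit .right k
        · obtain ⟨e, he⟩ := hB.exists_near .right k
          rw [htr, (leafOk_exit_right hB hk he).1]
          exact ((hr hk).resolve_left (htr ▸ heE)) e he
        · exact leafOk_new htl htr h3
  · exact (leafOk_old h2).1.2 (h e h3 heE)

theorem ordered_zero (E : Set (Edge n)) (x : Fin n → ℝ) : Ordered s B E 0 x := by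
  intro e _ _ g hg
  simp [tag] at hg

theorem near_of_one {k : Fin n} {e : Edge n} (h : B.inc k = [e]) (d : Side) : B.near d k = some e := by
  cases d <;> simp [near, h]

/-- If `k` merges `f` and `e`, then `x k` is the value of the label between them, so the leftmost
leaf of `k` inherits the order around `f` and the rightmost one the order around `e`. Exceptional
edges must propagate in the same way, as `h2` demands. -/
theorem Fits.ordered_succ (hB : B.IsSBush s) {E : Set (Edge n)} {k : Fin n} {x : Fin n → ℝ}
    (hf : Fits s B k x) (h : Ordered s B E k x) (h1 : ∀ e, B.inc k = [e] → e ∉ E)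
    (h2 : ∀ f e, B.inc k = [f, e] → (f ∈ E → B.exit .left k ∈ E) ∧ (e ∈ E → B.exit .right k ∈ E)) :
    Ordered s B E (k + 1) x := by
  have hmem : ∀ {e}, e ∈ B.inc k → e ∉ E → LeafOk s B k x e :=
    fun he => h _ (hB.mem_front_of_mem_inc he)
  refine h.succ hB (fun e _ he => hmem (by simp [he]) (h1 e he)) (fun _ => ?_) fun _ => ?_
  · rcases hB.inc_cases k with ⟨e', hk⟩ | ⟨f, e', hk⟩
    · refine .inr fun e he g hg => ?_
      obtain rfl : e' = e := by simpa [near_of_one hk] using he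
      exact (hf.1 _ hk).1 g hg
    · by_cases hE : f ∈ E
      · exact .inl ((h2 f e' hk).1 hE)
      · refine .inr fun e he g hg => ?_
        obtain rfl : f = e := by simpa [near, hk] using he
        obtain ⟨g', h1, h2⟩ := exists_tag_of_two hB hk
        rw [hf.2 _ _ hk g' h1]
        exact hmem (by simp [hk]) hE g hg g' h2
  · rcases hB.inc_cases k with ⟨e', hk⟩ | ⟨f, e', hk⟩
    · refine .inr fun e he g hg => ?_
      obtain rfl : e' = e := by simpa [near_of_one hk] using he
      exact (hf.1 _ hk).2 g hg
    · by_cases hE : e' ∈ E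
      · exact .inl ((h2 f e' hk).2 hE)
      · refine .inr fun e he g hg => ?_
        obtain rfl : e' = e := by simpa [near, hk] using he
        obtain ⟨g', h1, h2⟩ := exists_tag_of_two hB hk
        rw [hf.2 _ _ hk g' h1]
        exact hmem (by simp [hk]) hE g' h1 g hg

/-! ### Comparison with the insertion algorithm -/

theorem IsGaps.pairwise_lt {k : ℕ} {G : List (Tag n)} (hG : IsGaps s B k G) {x : Fin n → ℝ}
    (h : Ordered s B ∅ k x) : G.Pairwise fun g g' => g.val x < g'.val x := by
  have hlen := hG.length
  rw [← List.pairwise_map (f := Tag.val x) (R := (· < ·)), ← List.isChain_iff_pairwise,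
    List.isChain_iff_getElem]
  intro i hi
  simp only [List.length_map] at hi
  simp only [List.getElem_map]
  have hi' : i + 1 < (B.front k).length := by omega
  have h1 := congrArg (fun l => l[i + 1]?) hG.1
  have h2 := congrArg (fun l => l[i + 1]?) hG.2
  simp [hi', hi, show i < G.length by omega] at h1 h2
  exact h _ (List.getElem_mem hi') (by simp) _ h1 _ h2

theorem length_takeWhile_eq_iff {α : Type*} {p : α → Bool} {l : List α} {a : ℕ} (ha : a ≤ l.length) :
    (l.takeWhile p).length = a ↔ (∀ b ∈ l.take a, p b = true) ∧ ∀ b ∈ l[a]?, p b = false := by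
  induction l generalizing a with
  | nil => simp at ha; simp [ha]
  | cons c l ih =>
    cases a with
    | zero =>
      rw [List.takeWhile_cons]
      split_ifs with h <;> simp [h]
    | succ a =>
      rw [List.takeWhile_cons]
      split_ifs with h
      · simp [ih (by simpa using ha), h]
      · simp [h]

theorem pos_eq_iff {L : List (Edge n)} {G : List (Tag n)} {x : Fin n → ℝ} {v : ℝ} {a : ℕ}
    (ha : a ≤ G.length) : State.pos ⟨L, G.map Tag.pair⟩ x v = a ↔
      (∀ g ∈ G.take a, g.val x < v) ∧ ∀ g ∈ G[a]?, v ≤ g.val x := by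
  unfold State.pos
  rw [length_takeWhile_eq_iff (by simpa using ha)]
  simp only [← List.map_take, List.mem_map, forall_exists_index, and_imp, forall_apply_eq_imp_iff₂,
    List.getElem?_map, Option.mem_map, decide_eq_true_eq, decide_eq_false_iff_not, not_lt]
  exact Iff.rfl

theorem width_eq {L : List (Edge n)} {G : List (Tag n)} {x : Fin n → ℝ} {v : ℝ} {a : ℕ}
    (ha : State.pos ⟨L, G.map Tag.pair⟩ x v = a) [Decidable (∃ g ∈ G[a]?, v = g.val x)] :
    State.width ⟨L, G.map Tag.pair⟩ x v = if ∃ g ∈ G[a]?, v = g.val x then 2 else 1 := by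
  unfold State.width
  rw [ha]
  have : (∃ g ∈ (G.map Tag.pair)[a]?, v = x g.1 - g.2) ↔ ∃ g ∈ G[a]?, v = g.val x := by
    simp only [List.getElem?_map, Option.mem_map]
    constructor
    · rintro ⟨_, ⟨g, hg, rfl⟩, h⟩
      exact ⟨g, hg, h⟩
    · rintro ⟨g, hg, h⟩
      exact ⟨_, ⟨g, hg, rfl⟩, h⟩
  simp only [this]

theorem IsGaps.tag_near {k : Fin n} {A C : List (Edge n)} {G : List (Tag n)}
    (hG : IsGaps s B k G) (h : B.front k = A ++ B.inc k ++ C) {e : Edge n} :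
    (B.near .left k = some e → B.tag s k .left e = (G.take A.length).getLast?) ∧
    (B.near .right k = some e → B.tag s k .right e = G[A.length + (B.inc k).length - 1]?) := by
  constructor
  · intro he
    have h1 := congrArg List.getLast? (hG.split_left h he).1
    rw [List.getLast?_concat, List.getLast?_cons, List.getLast?_map] at h1
    cases h2 : (G.take A.length).getLast? <;> rw [h2] at h1 <;> simpa using h1
  · intro he
    have h1 := congrArg List.head? (hG.split_right h he).2
    rw [List.head?_cons, List.head?_append, List.head?_map, List.head?_drop] at h1
    cases h2 : G[A.length + (B.inc k).length - 1]? <;> rw [h2] at h1 <;> simpa using h1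

/-- The geometric meaning of `Fits`. -/
theorem fits_iff (hB : B.IsSBush s) {k : Fin n} {A C : List (Edge n)} {G : List (Tag n)}
    (hG : IsGaps s B k G) (h : B.front k = A ++ B.inc k ++ C) {x : Fin n → ℝ}
    (hx : Ordered s B ∅ k x) :
    Fits s B k x ↔ State.pos ⟨B.front k, G.map Tag.pair⟩ x (x k) = A.length ∧
      State.width ⟨B.front k, G.map Tag.pair⟩ x (x k) = (B.inc k).length := by
  classical
  have hlen := hG.length
  have hpw := hG.pairwise_lt hx
  rw [h, List.length_append, List.length_append] at hlen
  have hinc := List.length_pos_of_ne_nil (hB.inc_ne_nil k)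
  have hA : A.length ≤ G.length := by omega
  have htn := fun e => hG.tag_near (e := e) h
  rcases hB.inc_cases k with ⟨e, hk⟩ | ⟨f, e, hk⟩
  · have hl := (htn e).1 (near_of_one hk _)
    have hr := (htn e).2 (near_of_one hk _)
    rw [hk, List.length_singleton, Nat.add_sub_cancel] at hr
    have hF : Fits s B k x ↔ (∀ g ∈ (G.take A.length).getLast?, g.val x < x k) ∧
        ∀ g ∈ G[A.length]?, x k < g.val x := by
      rw [← hl, ← hr]
      simp [Fits, hk]
    rw [hF]
    constructor
    · rintro ⟨h1, h2⟩
      have hpos : State.pos ⟨B.front k, G.map Tag.pair⟩ x (x k) = A.length := by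
        rw [pos_eq_iff hA]
        refine ⟨fun g hg => ?_, fun g hg => (h2 g hg).le⟩
        have hne : G.take A.length ≠ [] := List.ne_nil_of_mem hg
        have h3 := h1 _ (List.getLast?_eq_some_getLast hne)
        have h4 : (G.take A.length).Pairwise fun g g' => g.val x < g'.val x :=
          hpw.sublist (List.take_sublist _ _)
        rw [← List.dropLast_append_getLast hne] at h4 hg
        rw [List.pairwise_append] at h4
        rcases List.mem_append.1 hg with hg | hg
        · exact (h4.2.2 g hg _ (by simp)).trans h3
        · rw [List.mem_singleton.1 hg]
          exact h3
      refine ⟨hpos, ?_⟩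
      rw [width_eq hpos, if_neg, hk]
      · rfl
      · rintro ⟨g, hg, h3⟩
        exact (h2 g hg).ne h3
    · rintro ⟨hpos, hw⟩
      rw [width_eq hpos, hk] at hw
      rw [pos_eq_iff hA] at hpos
      refine ⟨fun g hg => hpos.1 g (List.mem_of_mem_getLast? hg), fun g hg => ?_⟩
      refine lt_of_le_of_ne (hpos.2 g hg) fun h3 => ?_
      rw [if_pos ⟨g, hg, h3⟩] at hw
      simp at hw
  · have hl := (hG.tag_eq h hk).1
    rw [hk] at hlen
    simp only [List.length_cons, List.length_nil] at hlen
    have hlt : A.length < G.length := by omega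
    have hF : Fits s B k x ↔ ∀ g ∈ G[A.length]?, x k = g.val x := by
      rw [← hl]
      simp [Fits, hk]
    rw [hF]
    constructor
    · intro h1
      have hpos : State.pos ⟨B.front k, G.map Tag.pair⟩ x (x k) = A.length := by
        rw [pos_eq_iff hA]
        refine ⟨fun g hg => ?_, fun g hg => (h1 g hg).le⟩
        have h2 := h1 _ (List.getElem?_eq_getElem hlt)
        rw [h2]
        rw [← List.take_append_drop A.length G, List.pairwise_append] at hpw
        exact hpw.2.2 g hg _ (List.mem_of_getElem? (i := 0) (by simp [hlt]))
      refine ⟨hpos, ?_⟩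
      rw [width_eq hpos, if_pos, hk]
      · rfl
      · exact ⟨_, List.getElem?_eq_getElem hlt, h1 _ (List.getElem?_eq_getElem hlt)⟩
    · rintro ⟨hpos, hw⟩
      rw [width_eq hpos, hk] at hw
      intro g hg
      by_contra h1
      rw [if_neg] at hw
      · simp at hw
      · rintro ⟨g', hg', h2⟩
        rw [Option.mem_unique hg hg'] at h1
        exact h1 h2

/-- The length of the attached list gives the width, and its first leaf gives the position, since no
leaf is repeated. -/
theorem attached_eq_iff (hB : B.IsSBush s) {k : Fin n} {A C : List (Edge n)} {G : List (Tag n)}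
    (hG : IsGaps s B k G) (h : B.front k = A ++ B.inc k ++ C) {x : Fin n → ℝ} {v : ℝ} :
    State.attached ⟨B.front k, G.map Tag.pair⟩ x v = B.inc k ↔
      State.pos ⟨B.front k, G.map Tag.pair⟩ x v = A.length ∧
      State.width ⟨B.front k, G.map Tag.pair⟩ x v = (B.inc k).length := by
  classical
  have hlen := hG.length
  unfold State.attached
  have hpos : State.pos ⟨B.front k, G.map Tag.pair⟩ x v ≤ G.length := by
    unfold State.pos
    simpa using (List.takeWhile_sublist (l := G.map Tag.pair) _).length_le
  have hw := width_eq (L := B.front k) (G := G) (x := x) (v := v) rfl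
  generalize State.pos ⟨B.front k, G.map Tag.pair⟩ x v = a at *
  generalize State.width ⟨B.front k, G.map Tag.pair⟩ x v = w at *
  constructor
  · intro h1
    have h2 := congrArg List.length h1
    rw [List.length_take, List.length_drop] at h2
    change min w ((B.front k).length - a) = _ at h2
    have h3 : w = (B.inc k).length := by
      -- The `take` is never cut short: width two requires a gap at this position, hence a leaf
      -- after it.
      rw [← h2, eq_comm, min_eq_left]
      split_ifs at hw with h3
      · obtain ⟨g, hg, -⟩ := h3
        obtain ⟨h4, -⟩ := List.getElem?_eq_some_iff.1 hg
        omega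
      · omega
    refine ⟨?_, h3⟩
    have hinc := List.length_pos_of_ne_nil (hB.inc_ne_nil k)
    have h4 : (B.front k)[a]? = (B.front k)[A.length]? := by
      have h5 : (B.inc k)[0]? = (B.front k)[a]? := by
        rw [← h1, List.getElem?_take, if_pos (by omega), List.getElem?_drop, add_zero]
      rw [← h5, h, List.append_assoc, List.getElem?_append_right le_rfl, Nat.sub_self,
        List.getElem?_append_left hinc]
    exact (List.getElem?_inj (by omega) (hB.nodup_front k.2.le)).1 h4
  · rintro ⟨rfl, rfl⟩
    rw [h, List.append_assoc, List.drop_left' rfl, List.take_left' rfl]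

theorem insert_eq (hB : B.IsSBush s) {k : Fin n} {A C : List (Edge n)} {G : List (Tag n)}
    (h : B.front k = A ++ B.inc k ++ C)
    (h' : B.front (k + 1) = A ++ edgesFrom k (B.out k) ++ C) {x : Fin n → ℝ}
    (hp : State.pos ⟨B.front k, G.map Tag.pair⟩ x (x k) = A.length)
    (hw : State.width ⟨B.front k, G.map Tag.pair⟩ x (x k) = (B.inc k).length) :
    State.insert s x ⟨B.front k, G.map Tag.pair⟩ k = ⟨B.front (k + 1),
      (nextGaps s k G A.length (B.inc k).length (B.out k)).map Tag.pair⟩ := by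
  unfold State.insert
  rw [hp, hw, ← (hB k).2.2, State.mk.injEq]
  constructor
  · rw [h', h, List.append_assoc A, List.take_left' rfl, ← List.append_assoc A,
      List.drop_left' (by simp)]
  · simp only [nextGaps, List.map_append, List.map_map, ← List.map_take, ← List.map_drop]
    congr 2
    refine List.map_congr_left fun g _ => ?_
    simp [Tag.pair, Tag.push, add_assoc]

/-- While the nodes fit, the algorithm builds the leaves and the labels of the bush. -/
theorem run_eq (hB : B.IsSBush s) {x : Fin n → ℝ} : ∀ k ≤ n, (∀ j : Fin n, (j : ℕ) < k → Fits s B j x) →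
    Ordered s B ∅ k x ∧ ∃ G, IsGaps s B k G ∧ run s x k = ⟨B.front k, G.map Tag.pair⟩ := by
  refine level_induction ?_ ?_
  · exact fun _ => ⟨ordered_zero _ _, [], isGaps_zero, rfl⟩
  · intro k ih hf
    obtain ⟨ho, G, hG, hrun⟩ := ih fun j hj => hf j (by omega)
    obtain ⟨A, C, h, h'⟩ := hB.front_split k
    have hk := hf k (by omega)
    refine ⟨hk.ordered_succ hB ho (by simp) (by simp), _, hG.succ hB h h', ?_⟩
    obtain ⟨hp, hw⟩ := (fits_iff hB hG h ho).1 hk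
    rw [run, dif_pos k.2, hrun]
    exact insert_eq hB h h' hp hw

/-- Once the smaller nodes fit, the algorithm holds exactly the leaves and labels of `B`, so `j` is
attached as in `B` if and only if it fits too. -/
theorem mem_fiber_iff (hB : B.IsSBush s) {x : Fin n → ℝ} : x ∈ fiber s B ↔ ∀ j, Fits s B j x := by
  constructor
  · intro hx
    have hinc : ∀ j : Fin n, (run s x j).attached x (x j) = B.inc j :=
      fun j => congrFun (congrArg Bush.inc hx) j
    have : ∀ k ≤ n, ∀ j : Fin n, (j : ℕ) < k → Fits s B j x := by
      refine level_induction (by simp) fun k ih j hj => ?_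
      by_cases hjk : j = k
      · subst hjk
        obtain ⟨ho, G, hG, hrun⟩ := run_eq hB j j.2.le ih
        obtain ⟨A, C, h, h'⟩ := hB.front_split j
        rw [fits_iff hB hG h ho, ← attached_eq_iff hB hG h, ← hrun]
        exact hinc j
      · exact ih j (by omega)
    exact fun j => this n le_rfl j j.2
  · intro hx
    have key : ∀ j : Fin n, (run s x j).attached x (x j) = B.inc j ∧
        numOut (s j) ((run s x j).width x (x j)) = B.out j := by
      intro j
      obtain ⟨ho, G, hG, hrun⟩ := run_eq hB j j.2.le fun i _ => hx i
      obtain ⟨A, C, h, h'⟩ := hB.front_split j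
      have hf := (fits_iff hB hG h ho).1 (hx j)
      rw [hrun, attached_eq_iff hB hG h, (hB j).2.2, hf.2]
      exact ⟨⟨hf.1, rfl⟩, rfl⟩
    exact Bush.ext (funext fun j => (key j).2) (funext fun j => (key j).1)

/-! ### Points built coordinate by coordinate, and the closure of the fiber -/

theorem val_congr {x y : Fin n → ℝ} {g : Tag n} (h : x g.node = y g.node) : g.val x = g.val y := by
  simp only [Tag.val, h]

theorem Ordered.congr (hB : B.IsSBush s) {E : Set (Edge n)} {k : ℕ} (hk : k ≤ n) {x y : Fin n → ℝ}
    (hxy : ∀ i : Fin n, (i : ℕ) < k → x i = y i) (h : Ordered s B E k x) : Ordered s B E k y := by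
  intro e he heE g hg g' hg'
  rw [← val_congr (hxy _ (node_lt hB hk he hg)), ← val_congr (hxy _ (node_lt hB hk he hg'))]
  exact h e he heE g hg g' hg'

theorem val_congr_of_mem_inc (hB : B.IsSBush s) {j : Fin n} {x y : Fin n → ℝ}
    (hxy : ∀ i < j, x i = y i) {d : Side} {e : Edge n} {g : Tag n} (he : e ∈ B.inc j)
    (hg : g ∈ B.tag s j d e) : g.val x = g.val y :=
  val_congr (hxy _ (node_lt hB j.2.le (hB.mem_front_of_mem_inc he) hg))

theorem Fits.congr (hB : B.IsSBush s) {j : Fin n} {x y : Fin n → ℝ} (hxy : ∀ i ≤ j, x i = y i)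
    (h : Fits s B j x) : Fits s B j y := by
  have hv := @val_congr_of_mem_inc _ _ _ hB j x y fun i hi => hxy i hi.le
  refine ⟨fun e he => ⟨fun g hg => ?_, fun g hg => ?_⟩, fun f e he g hg => ?_⟩
  · rw [← hv (by simp [he]) hg, ← hxy j le_rfl]
    exact (h.1 e he).1 g hg
  · rw [← hv (by simp [he]) hg, ← hxy j le_rfl]
    exact (h.1 e he).2 g hg
  · rw [← hv (by simp [he]) hg, ← hxy j le_rfl]
    exact h.2 f e he g hg

/-- Construction of a point, one coordinate after the other. -/
theorem exists_point (s : Fin n → ℕ) (B : Bush n) (E : Set (Edge n)) (P : Fin n → (Fin n → ℝ) → Prop)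
    (hP : ∀ j x y, (∀ i ≤ j, x i = y i) → P j x → P j y)
    (h : ∀ (k : Fin n) x, Ordered s B E k x →
      ∃ y : Fin n → ℝ, (∀ i < k, x i = y i) ∧ P k y ∧ Ordered s B E (k + 1) y) :
    ∃ x, ∀ j, P j x := by
  have : ∀ k ≤ n, ∃ x, (∀ j : Fin n, (j : ℕ) < k → P j x) ∧ Ordered s B E k x := by
    refine level_induction ⟨0, by simp, ordered_zero _ _⟩ ?_
    rintro k ⟨x, hx, ho⟩
    obtain ⟨y, hxy, hy, hoy⟩ := h k x ho
    refine ⟨y, fun j hj => ?_, hoy⟩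
    by_cases hjk : j = k
    · exact hjk ▸ hy
    · have hjk : j < k := by omega
      exact hP j x y (fun i hi => hxy i (hi.trans_lt hjk)) (hx j hjk)
  obtain ⟨x, hx, -⟩ := this n le_rfl
  exact ⟨x, fun j => hx j j.2⟩

theorem exists_between_options {a b : Option (Tag n)} {x : Fin n → ℝ}
    (h : ∀ g ∈ a, ∀ g' ∈ b, g.val x < g'.val x) :
    ∃ v, (∀ g ∈ a, g.val x < v) ∧ ∀ g ∈ b, v < g.val x := by
  cases a with
  | none =>
    cases b with
    | none => exact ⟨0, by simp, by simp⟩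
    | some g => exact ⟨g.val x - 1, by simp, by simp⟩
  | some g =>
    cases b with
    | none => exact ⟨g.val x + 1, by simp, by simp⟩
    | some g' =>
      obtain ⟨v, h1, h2⟩ := exists_between (h g rfl g' rfl)
      exact ⟨v, by simpa using h1, by simpa using h2⟩

theorem update_eq_of_lt {k : Fin n} (x : Fin n → ℝ) (v : ℝ) :
    ∀ i < k, x i = Function.update x k v i := fun _ hi =>
  (Function.update_of_ne hi.ne _ _).symm

/-- At a node of indegree one, the labels around its leaf are in order and leave room for a value;
at a merging node the value is forced. -/
theorem exists_fits (hB : B.IsSBush s) {E : Set (Edge n)} {k : Fin n} {x : Fin n → ℝ}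
    (h : Ordered s B E k x) (h1 : ∀ e, B.inc k = [e] → e ∉ E)
    (h2 : ∀ f e, B.inc k = [f, e] → (f ∈ E → B.exit .left k ∈ E) ∧ (e ∈ E → B.exit .right k ∈ E)) :
    ∃ y : Fin n → ℝ, (∀ i < k, x i = y i) ∧ Fits s B k y ∧ Ordered s B E (k + 1) y := by
  suffices ∃ v, Fits s B k (Function.update x k v) by
    obtain ⟨v, hv⟩ := this
    exact ⟨_, update_eq_of_lt x v, hv,
      hv.ordered_succ hB (h.congr hB k.2.le (update_eq_of_lt x v)) h1 h2⟩
  have hv := fun v => @val_congr_of_mem_inc _ _ _ hB k x _ (update_eq_of_lt x v)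
  rcases hB.inc_cases k with ⟨e, hk⟩ | ⟨f, e, hk⟩
  · have he : e ∈ B.inc k := by simp [hk]
    obtain ⟨v, hl, hr⟩ := exists_between_options (h e (hB.mem_front_of_mem_inc he) (h1 e hk))
    refine ⟨v, fun e' he' => ?_, fun f e' he' => by simp [hk] at he'⟩
    obtain rfl : e = e' := by simpa [hk] using he'
    rw [Function.update_self]
    exact ⟨fun g hg => (hv v he hg) ▸ hl g hg, fun g hg => (hv v he hg) ▸ hr g hg⟩
  · have he : e ∈ B.inc k := by simp [hk]
    obtain ⟨g, hg, -⟩ := exists_tag_of_two hB hk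
    refine ⟨g.val x, fun e' he' => by simp [hk] at he', fun f' e' he' g' hg' => ?_⟩
    obtain ⟨rfl, rfl⟩ : f = f' ∧ e = e' := by simpa [hk] using he'
    rw [hg] at hg'
    cases hg'
    rw [Function.update_self]
    exact hv _ he hg

theorem exists_mem_fiber (hB : B.IsSBush s) : ∃ x, x ∈ fiber s B := by
  simp only [mem_fiber_iff hB]
  exact exists_point s B ∅ _ (fun j x y => Fits.congr hB) fun k x h =>
    exists_fits hB h (by simp) (by simp)

theorem val_add_smul (y w : Fin n → ℝ) (t : ℝ) (g : Tag n) :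
    g.val (y + t • w) = g.val y + t * w g.node := by
  simp only [Tag.val, Pi.add_apply, Pi.smul_apply, smul_eq_mul]
  ring

theorem continuous_val (g : Tag n) : Continuous fun x : Fin n → ℝ => g.val x := by
  unfold Tag.val
  fun_prop

/-- The closed fiber is given by the weak inequalities. -/
theorem closedFiber_eq (hB : B.IsSBush s) : closedFiber s B = {x | ∀ j, FitsWeakly s B j x} := by
  apply Set.Subset.antisymm
  · refine closure_minimal (fun x hx j => ((mem_fiber_iff hB).1 hx j).fitsWeakly) ?_
    simp only [FitsWeakly, Set.ofPred_forall, Set.ofPred_and]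
    refine isClosed_iInter fun j => .inter (isClosed_iInter fun e => isClosed_iInter fun _ => .inter ?_ ?_) ?_
    · exact isClosed_iInter fun g => isClosed_iInter fun _ =>
        isClosed_le (continuous_val g) (continuous_apply j)
    · exact isClosed_iInter fun g => isClosed_iInter fun _ =>
        isClosed_le (continuous_apply j) (continuous_val g)
    · exact isClosed_iInter fun f => isClosed_iInter fun e => isClosed_iInter fun _ =>
        isClosed_iInter fun g => isClosed_iInter fun _ =>
          isClosed_eq (continuous_apply j) (continuous_val g)
  · intro y hy
    obtain ⟨x, hx⟩ := exists_mem_fiber hB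
    rw [mem_fiber_iff hB] at hx
    -- All conditions are affine. Moving from the weak solution `y` towards the strict solution `x`
    -- makes every inequality strict and preserves the equalities.
    have hmem : ∀ t ∈ Set.Ioo (0 : ℝ) 1, y + t • (x - y) ∈ fiber s B := by
      rintro t ⟨ht0, ht1⟩
      rw [mem_fiber_iff hB]
      intro j
      have hval : ∀ g : Tag n, g.val (y + t • (x - y)) = (1 - t) * g.val y + t * g.val x := by
        intro g
        rw [val_add_smul]
        simp only [Tag.val, Pi.sub_apply]
        ring
      have hj : (y + t • (x - y)) j = (1 - t) * y j + t * x j := by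
        simp only [Pi.add_apply, Pi.smul_apply, Pi.sub_apply, smul_eq_mul]
        ring
      have hlt : ∀ {a b a' b' : ℝ}, a ≤ b → a' < b' → (1 - t) * a + t * a' < (1 - t) * b + t * b' :=
        fun h h' => add_lt_add_of_le_of_lt (mul_le_mul_of_nonneg_left h (by linarith))
          (mul_lt_mul_of_pos_left h' ht0)
      refine ⟨fun e he => ⟨fun g hg => ?_, fun g hg => ?_⟩, fun f e he g hg => ?_⟩
      · rw [hval, hj]
        exact hlt (((hy j).1 e he).1 g hg) (((hx j).1 e he).1 g hg)
      · rw [hval, hj]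
        exact hlt (((hy j).1 e he).2 g hg) (((hx j).1 e he).2 g hg)
      · rw [hval, hj, (hy j).2 f e he g hg, (hx j).2 f e he g hg]
    have ht : Filter.Tendsto (fun t : ℝ => y + t • (x - y)) (nhdsWithin 0 (Set.Ioi 0)) (nhds y) := by
      have hc : Continuous fun t : ℝ => y + t • (x - y) := by fun_prop
      have := hc.tendsto 0
      simp only [zero_smul, add_zero] at this
      exact this.mono_left nhdsWithin_le_nhds
    refine mem_closure_of_tendsto ht ?_
    filter_upwards [Ioo_mem_nhdsGT (zero_lt_one' ℝ)] with t ht using hmem t ht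

/-! ### Zigzags -/

theorem crosses_iff (hB : B.IsSBush s) {m : Fin n} {f e : Edge n} (hm : B.inc m = [f, e]) {d : Side} :
    (B.Crosses d f m ↔ d = .right) ∧ (B.Crosses d e m ↔ d = .left) := by
  have hne := hB.nodup_inc m
  rw [hm] at hne
  simp only [List.nodup_cons, List.mem_singleton, List.not_mem_nil, not_false_eq_true, List.nodup_nil,
    and_true] at hne
  cases d <;> simp [Crosses, hm, hne, Ne.symm hne]

/-- Keeping and turning combine into one rule: at a node of indegree two, the zigzag leaves on the
side through which it entered, whichever side it was following before. -/
theorem Zigzag.step_two (hB : B.IsSBush s) {d d' : Side} {j k m : Fin n} {f e : Edge n}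
    (h : B.Zigzag d j d' k) (hm : B.inc m = [f, e]) :
    (f = B.exit d' k → B.Zigzag d j .left m) ∧ (e = B.exit d' k → B.Zigzag d j .right m) := by
  constructor
  · rintro rfl
    have hc := fun d => (crosses_iff hB hm (d := d)).1
    cases d'
    · exact h.keep (by simp [hm]) (by simp [hc])
    · exact h.turn (by simp [hm]) (by simp [hc])
  · rintro rfl
    have hc := fun d => (crosses_iff hB hm (d := d)).2
    cases d'
    · exact h.turn (by simp [hm]) (by simp [hc])
    · exact h.keep (by simp [hm]) (by simp [hc])

theorem Zigzag.step_one {d d' : Side} {j k m : Fin n}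
    (h : B.Zigzag d j d' k) (hm : B.inc m = [B.exit d' k]) : B.Zigzag d j d' m :=
  h.keep (by simp [hm]) (by cases d' <;> simp [Crosses, hm])

theorem lt_of_exit_mem_inc (hB : B.IsSBush s) {d : Side} {k m : Fin n} (h : B.exit d k ∈ B.inc m) :
    k < m := by
  cases d <;> exact hB.lt_of_mem_inc h

theorem Zigzag.le (hB : B.IsSBush s) {d d' : Side} {j k : Fin n} (h : B.Zigzag d j d' k) : j ≤ k := by
  induction h with
  | start => exact le_rfl
  | keep _ hm _ ih => exact ih.trans (lt_of_exit_mem_inc hB hm).le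
  | turn _ hm _ ih => exact ih.trans (lt_of_exit_mem_inc hB hm).le

/-- Later nodes push both labels equally, so the order around a leaf is decided when the leaf is
created. -/
theorem leafWeaklyOk_iff_of_lt {k : Fin n} {e : Edge n} (he : e.1 = some k) {x : Fin n → ℝ} :
    ∀ m ≤ n, (k : ℕ) < m → (LeafWeaklyOk s B m x e ↔ LeafWeaklyOk s B (k + 1) x e) := by
  refine level_induction (by simp) fun m ih hkm => ?_
  by_cases h : k = m
  · rw [h]
  · rw [(leafOk_old (by rw [he]; simpa using h)).2, ih (by omega)]

theorem out_ne_one_of_two (hB : B.IsSBush s) {k : Fin n} {f e : Edge n} (h : B.inc k = [f, e]) :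
    B.out k ≠ 1 := fun h1 => by
  obtain ⟨-, e', h2⟩ := out_eq_one hB h1
  simp [h] at h2

/-- An inequality at `j` follows from the order of the labels around the leaves of the zigzag. -/
theorem Zigzag.implies (hB : B.IsSBush s) {d d' : Side} {j k : Fin n} {e : Edge n} {x : Fin n → ℝ}
    (hj : B.inc j = [e]) (hs : s j ≠ 0) (hx : ∀ k > j, FitsWeakly s B k x) (h : B.Zigzag d j d' k) :
    (∀ g ∈ B.tag s j d e, SideLe x d g (x j)) ∨ ((k = j ∨ (B.inc k).length = 2) ∧
      (LeafWeaklyOk s B (k + 1) x (B.exit d' k) → ∀ g ∈ B.tag s j d e, SideLe x d g (x j))) := by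
  -- If `m` has indegree one, its value is squeezed between the labels of the leaf, which proves
  -- their order. If `m` merges two leaves, its value is the label between them, and the order
  -- around the zigzag leaf follows from that around the exit of `m` on the side of entry.
  have step : ∀ {d' δ : Side} {k m : Fin n}, B.Zigzag d j d' k → B.exit d' k ∈ B.inc m →
      (∀ f e', B.inc m = [f, e'] → (f = B.exit d' k → δ = .left) ∧ (e' = B.exit d' k → δ = .right)) →
      ((∀ g ∈ B.tag s j d e, SideLe x d g (x j)) ∨ ((k = j ∨ (B.inc k).length = 2) ∧
        (LeafWeaklyOk s B (k + 1) x (B.exit d' k) → ∀ g ∈ B.tag s j d e, SideLe x d g (x j)))) →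
      ((∀ g ∈ B.tag s j d e, SideLe x d g (x j)) ∨ ((m = j ∨ (B.inc m).length = 2) ∧
        (LeafWeaklyOk s B (m + 1) x (B.exit δ m) → ∀ g ∈ B.tag s j d e, SideLe x d g (x j)))) := by
    rintro d' δ k m hk hm hδ (ih | ⟨-, ih⟩)
    · exact .inl ih
    · have hkm := lt_of_exit_mem_inc hB hm
      have hxm := hx m ((hk.le hB).trans_lt hkm)
      rw [← leafWeaklyOk_iff_of_lt (exit_fst d' k) m m.2.le hkm] at ih
      rcases hB.inc_cases m with ⟨e', hm'⟩ | ⟨f, e', hm'⟩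
      · refine .inl (ih fun g hg g' hg' => ?_)
        obtain rfl : B.exit d' k = e' := by simpa [hm'] using hm
        exact ((hxm.1 _ hm').1 g hg).trans ((hxm.1 _ hm').2 g' hg')
      · refine .inr ⟨.inr (by simp [hm']), fun hok => ih ?_⟩
        have hout := out_ne_one_of_two hB hm'
        obtain ⟨g₀, hg₀, hg₀'⟩ := exists_tag_of_two hB hm'
        have hxg := hxm.2 f e' hm' g₀ hg₀
        have hm2 : f = B.exit d' k ∨ e' = B.exit d' k := by
          simpa [hm', eq_comm] using hm
        rcases hm2 with rfl | rfl
        · obtain rfl := (hδ _ _ hm').1 rfl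
          rw [(leafOk_exit_left hB hout (e := B.exit d' k) (by simp [near, hm'])).2] at hok
          intro g hg g' hg'
          rw [hg₀'] at hg'
          cases hg'
          rw [← hxg]
          exact hok g hg
        · obtain rfl := (hδ _ _ hm').2 rfl
          rw [(leafOk_exit_right hB hout (e := B.exit d' k) (by simp [near, hm'])).2] at hok
          intro g hg g' hg'
          rw [hg₀] at hg
          cases hg
          rw [← hxg]
          exact hok g' hg'
  induction h with
  | start =>
    refine .inr ⟨.inl rfl, fun hok => ?_⟩
    have hout : B.out j ≠ 1 := fun h => hs (out_eq_one hB h).1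
    cases d
    · rwa [(leafOk_exit_left hB hout (near_of_one hj _)).2] at hok
    · rwa [(leafOk_exit_right hB hout (near_of_one hj _)).2] at hok
  | @keep d' k m hk hm hc ih =>
    refine step hk hm (fun f e' hm' => ⟨?_, ?_⟩) ih <;> rintro rfl
    · rw [(crosses_iff hB hm').1] at hc
      cases d'
      · rfl
      · exact absurd rfl hc
    · rw [(crosses_iff hB hm').2] at hc
      cases d'
      · exact absurd rfl hc
      · rfl
  | @turn d' k m hk hm hc ih =>
    refine step hk hm (fun f e' hm' => ⟨?_, ?_⟩) ih <;> rintro rfl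
    · rw [(crosses_iff hB hm').1] at hc
      rw [hc]
      rfl
    · rw [(crosses_iff hB hm').2] at hc
      rw [hc]
      rfl

/-- When `Kept` fails, the zigzag meets another node that does not have indegree two; there the
chain of reductions in `Zigzag.implies` has already been closed. -/
theorem sideLe_of_not_kept (hB : B.IsSBush s) {d : Side} {j : Fin n} {e : Edge n} {x : Fin n → ℝ}
    (hj : B.inc j = [e]) (hx : ∀ k > j, FitsWeakly s B k x) (h : ¬ Kept s B d j) :
    ∀ g ∈ B.tag s j d e, SideLe x d g (x j) := by
  simp only [Kept, not_or, not_forall] at h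
  obtain ⟨hs, d', k, hk, hkj, hlen⟩ := h
  rcases hk.implies hB hj hs hx with h | ⟨h | h, -⟩
  · exact h
  · exact absurd h hkj
  · exact absurd h hlen

/-- The system describes the closed fiber. -/
theorem forall_fitsWeakly_iff (hB : B.IsSBush s) {x : Fin n → ℝ} :
    (∀ j, FitsWeakly s B j x) ↔ ∀ c ∈ system s B, c.Holds s B x := by
  rw [system_iff hB]
  constructor
  · intro h
    refine ⟨fun j f e g hj hg => ?_, fun j e g hj hg _ => ?_, fun j e g hj hg _ => ?_⟩
    · exact (hole_holds_iff hB hj hg x).2 ((h j).2 f e hj g hg)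
    · exact (ascent_holds_iff hB hj hg x).2 (((h j).1 e hj).1 g hg)
    · exact (descent_holds_iff hB hj hg x).2 (((h j).1 e hj).2 g hg)
  · rintro ⟨h1, h2, h3⟩ j
    -- The induction runs from larger to smaller nodes, since a redundant inequality at `j` follows
    -- from the conditions at the nodes above it.
    induction j using WellFoundedGT.induction with
    | ind j ih =>
      refine ⟨fun e he => ⟨fun g hg => ?_, fun g hg => ?_⟩, fun f e he g hg => ?_⟩
      · by_cases hk : Kept s B .left j
        · exact (ascent_holds_iff hB he hg x).1 (h2 j e g he hg hk)
        · exact sideLe_of_not_kept hB he ih hk g hg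
      · by_cases hk : Kept s B .right j
        · exact (descent_holds_iff hB he hg x).1 (h3 j e g he hg hk)
        · exact sideLe_of_not_kept hB he ih hk g hg
      · exact (hole_holds_iff hB he hg x).1 (h1 j f e g he hg)

/-! ### Irredundancy -/

/-- A point that fits at all nodes except `j`, where it is prescribed. -/
theorem exists_fits_except (hB : B.IsSBush s) (E : Set (Edge n)) (j : Fin n)
    (V : (Fin n → ℝ) → Prop) (hV : ∀ x y, (∀ i ≤ j, x i = y i) → V x → V y)
    (h1 : ∀ k ≠ j, ∀ e, B.inc k = [e] → e ∉ E)
    (h2 : ∀ k f e, B.inc k = [f, e] → (f ∈ E → B.exit .left k ∈ E) ∧ (e ∈ E → B.exit .right k ∈ E))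
    (h : ∀ x, Ordered s B E j x →
      ∃ y : Fin n → ℝ, (∀ i < j, x i = y i) ∧ V y ∧ Ordered s B E (j + 1) y) :
    ∃ x, V x ∧ ∀ k ≠ j, Fits s B k x := by
  suffices ∃ x, ∀ k, if k = j then V x else Fits s B k x by
    obtain ⟨x, hx⟩ := this
    exact ⟨x, by simpa using hx j, fun k hk => by simpa [hk] using hx k⟩
  refine exists_point s B E (fun k x => if k = j then V x else Fits s B k x) ?_ ?_
  · intro k x y hxy hk
    by_cases hkj : k = j
    · subst hkj
      simp only [if_true] at hk ⊢
      exact hV x y hxy hk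
    · simp only [hkj, if_false] at hk ⊢
      exact hk.congr hB hxy
  · intro k x ho
    by_cases hkj : k = j
    · subst hkj
      simpa using h x ho
    · simpa [hkj] using exists_fits hB ho (h1 k hkj) (h2 k)

/-- The edges that the zigzags of a node with several outgoing edges follow. -/
def zigzagEdges (s : Fin n → ℕ) (B : Bush n) (d : Side) (j : Fin n) : Set (Edge n) :=
  {e | s j ≠ 0 ∧ ∃ d' k, B.Zigzag d j d' k ∧ e = B.exit d' k}

/-- A zigzag edge that enters a node of indegree one would put this node on the zigzag, beyond `j`,
against `Kept`. -/
theorem not_mem_zigzagEdges (hB : B.IsSBush s) {d : Side} {j : Fin n} (hk : Kept s B d j)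
    {m : Fin n} {e : Edge n} (hm : B.inc m = [e]) : e ∉ zigzagEdges s B d j := by
  rintro ⟨hs, d', k, hz, rfl⟩
  have hlt := (hz.le hB).trans_lt (lt_of_exit_mem_inc hB (d := d') (k := k) (m := m) (by simp [hm]))
  have := hk.resolve_left hs d' m (hz.step_one hm) hlt.ne'
  simp [hm] at this

theorem exit_mem_zigzagEdges (hB : B.IsSBush s) {d : Side} {j m : Fin n} {f e : Edge n}
    (hm : B.inc m = [f, e]) : (f ∈ zigzagEdges s B d j → B.exit .left m ∈ zigzagEdges s B d j) ∧
      (e ∈ zigzagEdges s B d j → B.exit .right m ∈ zigzagEdges s B d j) := by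
  constructor
  · rintro ⟨hs, d', k, hz, hf⟩
    exact ⟨hs, _, m, (hz.step_two hB hm).1 hf, rfl⟩
  · rintro ⟨hs, d', k, hz, hf⟩
    exact ⟨hs, _, m, (hz.step_two hB hm).2 hf, rfl⟩

theorem exit_mem_zigzagEdges_self (hB : B.IsSBush s) (d : Side) {j : Fin n} {e : Edge n}
    (hj : B.inc j = [e]) (hout : B.out j ≠ 1) : B.exit d j ∈ zigzagEdges s B d j := by
  refine ⟨fun hs => hout ?_, d, j, .start, rfl⟩
  rw [(hB j).2.2, hj, hs]
  rfl

/-- Let `x j` be above the label `g` but below the next label, if any. The leftmost leaf of `j`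
stays in order because the left label of `f` is below `g`, and the rightmost one by the choice of `x
j`; so no exceptional edges are needed. -/
theorem exists_violating_hole (hB : B.IsSBush s) {j : Fin n} {f e : Edge n} {g : Tag n}
    (hj : B.inc j = [f, e]) (hg : B.tag s j .left e = some g) :
    ∃ x, x j ≠ g.val x ∧ ∀ k ≠ j, Fits s B k x := by
  have he : e ∈ B.inc j := by simp [hj]
  have hf : f ∈ B.inc j := by simp [hj]
  have hgj := node_lt hB j.2.le (hB.mem_front_of_mem_inc he) hg
  refine exists_fits_except hB ∅ j (fun x => x j ≠ g.val x) (fun x y hxy h => ?_) (by simp) (by simp) ?_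
  · rw [← hxy j le_rfl, ← val_congr (hxy g.node hgj.le)]
    exact h
  · intro x ho
    obtain ⟨v, hl, hr⟩ := exists_between_options
      (ho e (hB.mem_front_of_mem_inc he) (by simp))
    have hxy := update_eq_of_lt (k := j) x v
    have hv := @val_congr_of_mem_inc _ _ _ hB j x _ hxy
    have hlt : g.val (Function.update x j v) < Function.update x j v j := by
      rw [Function.update_self, ← val_congr (hxy g.node hgj)]
      exact hl g hg
    refine ⟨_, hxy, hlt.ne', (ho.congr hB j.2.le hxy).succ hB (fun e' _ h => by simp [hj] at h)
      (fun _ => .inr fun e' he' g' hg' => ?_) fun _ => .inr fun e' he' g' hg' => ?_⟩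
    · obtain rfl : f = e' := by simpa [near, hj] using he'
      obtain ⟨g₀, h1, h2⟩ := exists_tag_of_two hB hj
      rw [hg] at h1
      cases h1
      exact ((ho.congr hB j.2.le hxy) f (hB.mem_front_of_mem_inc hf) (by simp) g' hg' g h2).trans hlt
    · obtain rfl : e = e' := by simpa [near, hj] using he'
      rw [Function.update_self, ← hv he hg']
      exact hr g' hg'

/-- With `x j` one below the left label, the right condition at `j` still holds, as the labels of
the leaf are in order. If `s j ≠ 0`, disorder starts at the leftmost leaf of `j` and stays on the
zigzag, where by `Kept` no other node has indegree one; merging nodes can fit all the same. If `s j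
= 0`, there is no disorder at all. -/
theorem exists_violating_ascent (hB : B.IsSBush s) {j : Fin n} {e : Edge n} {g : Tag n}
    (hj : B.inc j = [e]) (hg : B.tag s j .left e = some g) (hk : Kept s B .left j) :
    ∃ x, (x j < g.val x ∧ ∀ g' ∈ B.tag s j .right e, x j < g'.val x) ∧ ∀ k ≠ j, Fits s B k x := by
  have he : e ∈ B.inc j := by simp [hj]
  have hef := hB.mem_front_of_mem_inc he
  have hgj := node_lt hB j.2.le hef hg
  refine exists_fits_except hB (zigzagEdges s B .left j) j _ (fun x y hxy h => ?_)
    (fun k _ e' => not_mem_zigzagEdges hB hk) (fun k f e' => exit_mem_zigzagEdges hB) ?_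
  · rw [← hxy j le_rfl, ← val_congr (hxy g.node hgj.le)]
    refine ⟨h.1, fun g' hg' => ?_⟩
    rw [← val_congr_of_mem_inc hB (fun i hi => hxy i hi.le) he hg']
    exact h.2 g' hg'
  · intro x ho
    have hxy := update_eq_of_lt (k := j) x (g.val x - 1)
    have hoy := ho.congr hB j.2.le hxy
    have hok := hoy e hef (not_mem_zigzagEdges hB hk hj)
    have hlt : Function.update x j (g.val x - 1) j < g.val (Function.update x j (g.val x - 1)) := by
      rw [Function.update_self, ← val_congr (hxy g.node hgj)]
      linarith
    have hlt' := fun g' hg' => hlt.trans (hok g hg g' hg')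
    refine ⟨_, hxy, ⟨hlt, hlt'⟩, hoy.succ hB (fun e' _ h => ?_)
      (fun hout => .inl (exit_mem_zigzagEdges_self hB _ hj hout)) fun _ => .inr fun e' he' => ?_⟩
    · obtain rfl : e = e' := by simpa [hj] using h
      exact hok
    · obtain rfl : e = e' := by simpa [near, hj] using he'
      exact hlt'

theorem exists_violating_descent (hB : B.IsSBush s) {j : Fin n} {e : Edge n} {g : Tag n}
    (hj : B.inc j = [e]) (hg : B.tag s j .right e = some g) (hk : Kept s B .right j) :
    ∃ x, (g.val x < x j ∧ ∀ g' ∈ B.tag s j .left e, g'.val x < x j) ∧ ∀ k ≠ j, Fits s B k x := by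
  have he : e ∈ B.inc j := by simp [hj]
  have hef := hB.mem_front_of_mem_inc he
  have hgj := node_lt hB j.2.le hef hg
  refine exists_fits_except hB (zigzagEdges s B .right j) j _ (fun x y hxy h => ?_)
    (fun k _ e' => not_mem_zigzagEdges hB hk) (fun k f e' => exit_mem_zigzagEdges hB) ?_
  · rw [← hxy j le_rfl, ← val_congr (hxy g.node hgj.le)]
    refine ⟨h.1, fun g' hg' => ?_⟩
    rw [← val_congr_of_mem_inc hB (fun i hi => hxy i hi.le) he hg']
    exact h.2 g' hg'
  · intro x ho
    have hxy := update_eq_of_lt (k := j) x (g.val x + 1)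
    have hoy := ho.congr hB j.2.le hxy
    have hok := hoy e hef (not_mem_zigzagEdges hB hk hj)
    have hlt : g.val (Function.update x j (g.val x + 1)) < Function.update x j (g.val x + 1) j := by
      rw [Function.update_self, ← val_congr (hxy g.node hgj)]
      linarith
    have hlt' := fun g' hg' => (hok g' hg' g hg).trans hlt
    refine ⟨_, hxy, ⟨hlt, hlt'⟩, hoy.succ hB (fun e' _ h => ?_) (fun _ => .inr fun e' he' => ?_)
      fun hout => .inl (exit_mem_zigzagEdges_self hB _ hj hout)⟩
    · obtain rfl : e = e' := by simpa [hj] using h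
      exact hok
    · obtain rfl : e = e' := by simpa [near, hj] using he'
      exact hlt'

/-- The system is irredundant. -/
theorem exists_violating (hB : B.IsSBush s) : ∀ c ∈ system s B, ∃ x : Fin n → ℝ,
    (∀ c' ∈ system s B, c' ≠ c → c'.Holds s B x) ∧ ¬ c.Holds s B x := by
  rw [system_iff hB]
  refine ⟨fun j f e g hj hg => ?_, fun j e g hj hg hkept => ?_, fun j e g hj hg hkept => ?_⟩
  · obtain ⟨x, hx, hf⟩ := exists_violating_hole hB hj hg
    refine ⟨x, ?_, fun h => hx ((hole_holds_iff hB hj hg x).1 h)⟩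
    rw [system_iff hB]
    refine ⟨fun k f' e' g' hk hg' hne => ?_, fun k e' g' hk hg' _ _ => ?_, fun k e' g' hk hg' _ _ => ?_⟩
    · by_cases hkj : k = j
      · subst hkj
        obtain ⟨rfl, rfl⟩ : f = f' ∧ e = e' := by simpa [hj] using hk
        rw [hg] at hg'
        cases hg'
        exact absurd rfl hne
      · exact (hole_holds_iff hB hk hg' x).2 ((hf k hkj).2 _ _ hk g' hg')
    · have hkj : k ≠ j := by rintro rfl; simp [hj] at hk
      exact (ascent_holds_iff hB hk hg' x).2 (((hf k hkj).1 _ hk).1 g' hg').le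
    · have hkj : k ≠ j := by rintro rfl; simp [hj] at hk
      exact (descent_holds_iff hB hk hg' x).2 (((hf k hkj).1 _ hk).2 g' hg').le
  · obtain ⟨x, ⟨hx, hx'⟩, hf⟩ := exists_violating_ascent hB hj hg hkept
    refine ⟨x, ?_, fun h => hx.not_ge ((ascent_holds_iff hB hj hg x).1 h)⟩
    rw [system_iff hB]
    refine ⟨fun k f' e' g' hk hg' _ => ?_, fun k e' g' hk hg' _ hne => ?_, fun k e' g' hk hg' _ _ => ?_⟩
    · have hkj : k ≠ j := by rintro rfl; simp [hj] at hk
      exact (hole_holds_iff hB hk hg' x).2 ((hf k hkj).2 _ _ hk g' hg')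
    · by_cases hkj : k = j
      · subst hkj
        obtain rfl : e = e' := by simpa [hj] using hk
        rw [hg] at hg'
        cases hg'
        exact absurd rfl hne
      · exact (ascent_holds_iff hB hk hg' x).2 (((hf k hkj).1 _ hk).1 g' hg').le
    · refine (descent_holds_iff hB hk hg' x).2 ?_
      by_cases hkj : k = j
      · subst hkj
        obtain rfl : e = e' := by simpa [hj] using hk
        exact (hx' g' hg').le
      · exact (((hf k hkj).1 _ hk).2 g' hg').le
  · obtain ⟨x, ⟨hx, hx'⟩, hf⟩ := exists_violating_descent hB hj hg hkept
    refine ⟨x, ?_, fun h => hx.not_ge ((descent_holds_iff hB hj hg x).1 h)⟩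
    rw [system_iff hB]
    refine ⟨fun k f' e' g' hk hg' _ => ?_, fun k e' g' hk hg' _ _ => ?_, fun k e' g' hk hg' _ hne => ?_⟩
    · have hkj : k ≠ j := by rintro rfl; simp [hj] at hk
      exact (hole_holds_iff hB hk hg' x).2 ((hf k hkj).2 _ _ hk g' hg')
    · refine (ascent_holds_iff hB hk hg' x).2 ?_
      by_cases hkj : k = j
      · subst hkj
        obtain rfl : e = e' := by simpa [hj] using hk
        exact (hx' g' hg').le
      · exact (((hf k hkj).1 _ hk).1 g' hg').le
    · by_cases hkj : k = j
      · subst hkj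
        obtain rfl : e = e' := by simpa [hj] using hk
        rw [hg] at hg'
        cases hg'
        exact absurd rfl hne
      · exact (descent_holds_iff hB hk hg' x).2 (((hf k hkj).1 _ hk).2 g' hg').le

/-! ### The dimension -/

/-- The linear space parallel to the closed fiber. -/
def directions (s : Fin n → ℕ) (B : Bush n) : Submodule ℝ (Fin n → ℝ) where
  carrier := {v | ∀ j f e, B.inc j = [f, e] → ∀ g ∈ B.tag s j .left e, v j = v g.node}
  add_mem' := fun h h' j f e hj g hg => by simp [h j f e hj g hg, h' j f e hj g hg]
  zero_mem' := by simp
  smul_mem' := fun c v h j f e hj g hg => by simp [h j f e hj g hg]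

/-- Moving along `directions` preserves the equalities exactly, and the strict inequalities are open
conditions. -/
theorem eventually_mem_fiber (hB : B.IsSBush s) {x v : Fin n → ℝ} (hx : x ∈ fiber s B)
    (hv : v ∈ directions s B) : ∀ᶠ t in nhds (0 : ℝ), x + t • v ∈ fiber s B := by
  simp only [mem_fiber_iff hB] at hx ⊢
  have hc : Continuous fun t : ℝ => x + t • v := by fun_prop
  have hlt : ∀ {φ ψ : (Fin n → ℝ) → ℝ}, Continuous φ → Continuous ψ → φ x < ψ x →
      ∀ᶠ t in nhds (0 : ℝ), φ (x + t • v) < ψ (x + t • v) := by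
    intro φ ψ hφ hψ h
    refine (hφ.comp hc).continuousAt.eventually_lt (hψ.comp hc).continuousAt ?_
    simpa using h
  rw [Filter.eventually_all]
  intro j
  rcases hB.inc_cases j with ⟨e, hj⟩ | ⟨f, e, hj⟩
  · have hl : ∀ᶠ t in nhds (0 : ℝ), ∀ g ∈ B.tag s j .left e, g.val (x + t • v) < (x + t • v) j := by
      cases hg : B.tag s j .left e with
      | none => simp
      | some g =>
        have := hlt (continuous_val g) (continuous_apply j) (((hx j).1 e hj).1 g hg)
        simpa using this
    have hr : ∀ᶠ t in nhds (0 : ℝ), ∀ g ∈ B.tag s j .right e, (x + t • v) j < g.val (x + t • v) := by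
      cases hg : B.tag s j .right e with
      | none => simp
      | some g =>
        have := hlt (continuous_apply j) (continuous_val g) (((hx j).1 e hj).2 g hg)
        simpa using this
    filter_upwards [hl, hr] with t h1 h2
    refine ⟨fun e' he' => ?_, fun f' e' h => by simp [hj] at h⟩
    obtain rfl : e = e' := by simpa [hj] using he'
    exact ⟨h1, h2⟩
  · refine Filter.Eventually.of_forall fun t => ⟨fun e' h => by simp [hj] at h, fun f' e' h g hg => ?_⟩
    rw [val_add_smul, Pi.add_apply, Pi.smul_apply, smul_eq_mul, (hx j).2 f' e' h g hg,
      hv j f' e' h g hg]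

/-- Differences of points lose the constants of the equalities. Conversely, a small positive
multiple of any direction joins two points of the fiber. -/
theorem direction_closedFiber (hB : B.IsSBush s) :
    (affineSpan ℝ (closedFiber s B)).direction = directions s B := by
  rw [direction_affineSpan]
  apply le_antisymm
  · rw [vectorSpan_def, Submodule.span_le]
    rintro _ ⟨y, hy, z, hz, rfl⟩ j f e hj g hg
    rw [closedFiber_eq hB] at hy hz
    have h1 := (hy j).2 f e hj g hg
    have h2 := (hz j).2 f e hj g hg
    simp only [Tag.val] at h1 h2
    simp only [vsub_eq_sub, Pi.sub_apply, h1, h2]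
    ring
  · intro v hv
    obtain ⟨x, hx⟩ := exists_mem_fiber hB
    have h := eventually_mem_fiber hB hx hv
    obtain ⟨t, ht, ht0⟩ := ((h.filter_mono nhdsWithin_le_nhds).and
      (self_mem_nhdsWithin : Set.Ioi (0 : ℝ) ∈ nhdsWithin 0 (Set.Ioi 0))).exists
    have hmem := vsub_mem_vectorSpan ℝ (subset_closure ht : _ ∈ closedFiber s B)
      (subset_closure hx : _ ∈ closedFiber s B)
    have := Submodule.smul_mem _ t⁻¹ hmem
    rwa [vsub_eq_sub, add_sub_cancel_left, smul_smul, inv_mul_cancel₀ (ne_of_gt ht0), one_smul] at this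

/-- Restriction to the nodes of indegree one is an isomorphism, because each other coordinate copies
that of a smaller node. -/
theorem finrank_directions (hB : B.IsSBush s) : Module.finrank ℝ (directions s B) = B.rank := by
  let φ : directions s B →ₗ[ℝ] ({j // (B.inc j).length = 1} → ℝ) :=
    { toFun := fun v j => v.1 j
      map_add' := fun _ _ => rfl
      map_smul' := fun _ _ => rfl }
  have hinj : Function.Injective φ := by
    rw [← LinearMap.ker_eq_bot, LinearMap.ker_eq_bot']
    intro v hv
    ext j
    induction j using WellFoundedLT.induction with
    | ind j ih =>
      rcases hB.inc_cases j with ⟨e, hj⟩ | ⟨f, e, hj⟩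
      · exact congrFun hv ⟨j, by simp [hj]⟩
      · obtain ⟨g, hg, -⟩ := exists_tag_of_two hB hj
        rw [v.2 j f e hj g hg]
        exact ih g.node (node_lt hB j.2.le (hB.mem_front_of_mem_inc (by simp [hj])) hg)
  have hsurj : Function.Surjective φ := by
    intro u
    suffices ∃ v : Fin n → ℝ, ∀ j, (∀ h : (B.inc j).length = 1, v j = u ⟨j, h⟩) ∧
        ∀ f e, B.inc j = [f, e] → ∀ g ∈ B.tag s j .left e, v j = v g.node by
      obtain ⟨v, hv⟩ := this
      exact ⟨⟨v, fun j => (hv j).2⟩, funext fun j => (hv j).1 j.2⟩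
    -- With every edge exceptional, the order condition is void, and `exists_point` is plain
    -- recursion on the coordinates.
    refine exists_point s B Set.univ (fun j v => (∀ h : (B.inc j).length = 1, v j = u ⟨j, h⟩) ∧
      ∀ f e, B.inc j = [f, e] → ∀ g ∈ B.tag s j .left e, v j = v g.node) ?_ ?_
    · rintro j x y hxy ⟨h1, h2⟩
      refine ⟨fun h => (hxy j le_rfl) ▸ h1 h, fun f e hj g hg => ?_⟩
      have := node_lt hB j.2.le (hB.mem_front_of_mem_inc (by simp [hj])) hg
      rw [← hxy j le_rfl, ← hxy g.node this.le]
      exact h2 f e hj g hg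
    · intro j x _
      rcases hB.inc_cases j with ⟨e, hj⟩ | ⟨f, e, hj⟩
      · refine ⟨Function.update x j (u ⟨j, by simp [hj]⟩), update_eq_of_lt x _, ⟨fun h => ?_,
          fun f e h => by simp [hj] at h⟩, fun _ _ h => absurd (Set.mem_univ _) h⟩
        rw [Function.update_self]
      · obtain ⟨g, hg, -⟩ := exists_tag_of_two hB hj
        have hlt := node_lt hB j.2.le (hB.mem_front_of_mem_inc (by simp [hj])) hg
        refine ⟨Function.update x j (x g.node), update_eq_of_lt x _, ⟨fun h => by simp [hj] at h,
          fun f' e' h g' hg' => ?_⟩, fun _ _ h => absurd (Set.mem_univ _) h⟩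
        obtain ⟨rfl, rfl⟩ : f = f' ∧ e = e' := by simpa [hj] using h
        rw [hg] at hg'
        cases hg'
        rw [Function.update_self]
        exact update_eq_of_lt x _ _ hlt
  rw [(LinearEquiv.ofBijective φ ⟨hinj, hsurj⟩).finrank_eq, Module.finrank_fintype_fun_eq_card,
    Fintype.card_subtype]
  rfl

end Bush
end SBush

theorem mainTheorem2 {n : ℕ} (s : Fin n → ℕ) (B : SBush.Bush n) (hB : B.IsSBush s) :
    -- the system describes the closed fiber
    SBush.closedFiber s B = {x | ∀ c ∈ SBush.system s B, c.Holds s B x} ∧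
    -- irredundantly: each equality or inequality is violated by a point that satisfies all others
    (∀ c ∈ SBush.system s B, ∃ x : Fin n → ℝ,
      (∀ c' ∈ SBush.system s B, c' ≠ c → c'.Holds s B x) ∧ ¬ c.Holds s B x) ∧
    -- the dimension is the rank
    (SBush.closedFiber s B).Nonempty ∧
    Module.finrank ℝ (affineSpan ℝ (SBush.closedFiber s B)).direction = B.rank := by
  refine ⟨?_, SBush.Bush.exists_violating hB, ?_, ?_⟩
  · rw [SBush.Bush.closedFiber_eq hB]
    ext x
    exact SBush.Bush.forall_fitsWeakly_iff hB
  · obtain ⟨x, hx⟩ := SBush.Bush.exists_mem_fiber hB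
    exact ⟨x, subset_closure hx⟩
  · rw [SBush.Bush.direction_closedFiber hB]
    exact SBush.Bush.finrank_directions hB
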